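/- Let $\mathcal A$ be a finite set with the discrete topology and let $\Omega\subseteq\mathcal A^{\mathbb Z}$ be a subshift, that is, a closed shift-invariant subset of $\mathcal A^{\mathbb Z}$ (with the product topology), and let $T:\Omega\to\Omega$, $(T\omega)_n=\omega_{n+1}$, be the shift. Suppose that $\Omega$ is aperiodic (no $\omega\in\Omega$ satisfies $T^p\omega=\omega$ for some $p\ge 1$) and satisfies the Boshernitzan condition: $(\Omega,T)$ is minimal, and there is a $T$-invariant Borel probability measure $\mu$ on $\Omega$ with $$\limsup_{n\to\infty}\; n\cdot\min\{\mu([w]) : w\in\Omega_n\}>0,$$ where $\Omega_n=\{\omega_1\cdots\omega_n:\omega\in\Omega\}$ and $[w]=\{\omega\in\Omega:\omega_1\cdots\omega_n=w\}$ for $w\in\Omega_n$. For a continuous map $A:\Omega\to\mathrm{SL}(2,\mathbb R)$ (a continuous cocycle) put $A_n(\omega)=A(T^{n-1}\omega)\cdots A(T\omega)A(\omega)$ for $n\ge 1$, and call $A$ uniform if there is a number $L(A)\in\mathbb R$ such that $\frac1n\log\|A_n(\omega)\|\to L(A)$ as $n\to\infty$, uniformly in $\omega\in\Omega$. Then the set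 of uniform cocycles is a dense $G_\delta$-set in the space $C(\Omega,\mathrm{SL}(2,\mathbb R))$ of all continuous cocycles, equipped with the topology of uniform convergence. -/

import Mathlib

open Filter Topology MeasureTheory SymbolicDynamics.FullShift
open scoped ENNReal MatrixGroups Matrix

namespace SL2Cocycle

section DynamicalSystem

variable {X : Type*} [TopologicalSpace X]

/-- A homeomorphism is minimal if every two-sided orbit is dense (non-emptiness of the space is
required separately). -/
def IsMinimal (T : X ≃ₜ X) : Prop :=
  ∀ x : X, Dense (Set.range fun n : ℤ => (T ^ n) x)

/-- A homeomorphism is aperiodic if it has no periodic points. -/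
def IsAperiodic (T : X ≃ₜ X) : Prop :=
  ∀ (x : X) (p : ℕ), 0 < p → T^[p] x ≠ x

/-- The iterates of a continuous `SL(2, ℝ)` cocycle over `T`, for `n ≥ 0`:
`A_n(ω) = A(T^{n-1} ω) ⋯ A(T ω) A(ω)`. -/
def iter (T : X ≃ₜ X) (A : C(X, SL(2, ℝ))) : ℕ → X → SL(2, ℝ)
  | 0, _ => 1
  | n + 1, ω => A (T^[n] ω) * iter T A n ω

/-- The skew-product `(T, A) : (ω, v) ↦ (T ω, A(ω) v)` on `X × ℝ²`. -/
def skewProduct (T : X ≃ₜ X) (A : C(X, SL(2, ℝ))) (z : X × (Fin 2 → ℝ)) : X × (Fin 2 → ℝ) :=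
  (T z.1, (A z.1 : Matrix (Fin 2) (Fin 2) ℝ) *ᵥ z.2)

/-- The iterates of the cocycle are those of the skew-product: `(T, A)^n = (T^n, A_n)`. -/
theorem skewProduct_iterate (T : X ≃ₜ X) (A : C(X, SL(2, ℝ))) (n : ℕ)
    (ω : X) (v : Fin 2 → ℝ) :
    (skewProduct T A)^[n] (ω, v) =
      (T^[n] ω, (iter T A n ω : Matrix (Fin 2) (Fin 2) ℝ) *ᵥ v) := by
  induction n with
  | zero => simp [iter]
  | succ n ih =>
    rw [Function.iterate_succ_apply', ih, Function.iterate_succ_apply']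
    simp only [skewProduct, iter, Matrix.SpecialLinearGroup.coe_mul, Matrix.mulVec_mulVec]

/-- The operator norm of an element of `SL(2, ℝ)` acting on Euclidean `ℝ²`. -/
noncomputable def opNorm (M : SL(2, ℝ)) : ℝ :=
  ‖Matrix.toEuclideanCLM (𝕜 := ℝ) (M : Matrix (Fin 2) (Fin 2) ℝ)‖

/-- A cocycle is uniform if `(1/n) log ‖A_n(ω)‖` converges to a constant, uniformly in `ω`. -/
def IsUniform (T : X ≃ₜ X) (A : C(X, SL(2, ℝ))) : Prop :=
  ∃ L : ℝ, TendstoUniformly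
    (fun (n : ℕ) (ω : X) => (1 / (n : ℝ)) * Real.log (opNorm (iter T A n ω)))
    (fun _ => L) atTop

end DynamicalSystem

section Subshift

variable {𝓐 : Type*} [TopologicalSpace 𝓐]

/-- The shift `(T ω)_n = ω_{n+1}` as a homeomorphism of a two-sided subshift. -/
def shiftHomeo (Ω : Subshift 𝓐 ℤ) : Ω.carrier ≃ₜ Ω.carrier where
  toFun ω := ⟨fun n => ω.1 (n + 1), by
    have h := Ω.mapsTo 1 ω.2
    have e : shift (1 : ℤ) ω.1 = fun n => ω.1 (n + 1) := by
      funext n; simp [shift, add_comm]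
    rwa [e] at h⟩
  invFun ω := ⟨fun n => ω.1 (n - 1), by
    have h := Ω.mapsTo (-1) ω.2
    have e : shift (-1 : ℤ) ω.1 = fun n => ω.1 (n - 1) := by
      funext n; simp [shift, sub_eq_add_neg, add_comm]
    rwa [e] at h⟩
  left_inv ω := by ext n; simp
  right_inv ω := by ext n; simp
  continuous_toFun := by
    refine Continuous.subtype_mk (continuous_pi fun n => ?_) _
    exact (continuous_apply (n + 1)).comp continuous_subtype_val
  continuous_invFun := by
    refine Continuous.subtype_mk (continuous_pi fun n => ?_) _
    exact (continuous_apply (n - 1)).comp continuous_subtype_val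

/-- The word `ω₁ … ω_n`. -/
def word (n : ℕ) (ω : ℤ → 𝓐) : Fin n → 𝓐 :=
  fun i => ω ((i : ℤ) + 1)

/-- The set `Ω_n` of words of length `n` occurring in elements of the subshift. -/
def words (Ω : Subshift 𝓐 ℤ) (n : ℕ) : Set (Fin n → 𝓐) :=
  word n '' Ω.carrier

/-- The cylinder set `[w] = {ω ∈ Ω : ω₁ … ω_n = w}`. -/
def wordCylinder (Ω : Subshift 𝓐 ℤ) {n : ℕ} (w : Fin n → 𝓐) : Set Ω.carrier :=
  {ω | word n ω.1 = w}

/-- The Boshernitzan condition (B): the subshift is minimal and there is a shift-invariant Borel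
probability measure `μ` on it with `limsup n · min {μ([w]) : w ∈ Ω_n} > 0`. The `limsup` is taken
in `[0, ∞]`; over a finite alphabet the infimum is over a finite non-empty set, hence a minimum. -/
def Boshernitzan (Ω : Subshift 𝓐 ℤ) : Prop :=
  IsMinimal (shiftHomeo Ω) ∧
  ∃ (_ : MeasurableSpace Ω.carrier) (_ : BorelSpace Ω.carrier) (μ : Measure Ω.carrier),
    IsProbabilityMeasure μ ∧ MeasurePreserving (shiftHomeo Ω) μ μ ∧
    0 < limsup (fun n : ℕ => (n : ℝ≥0∞) * ⨅ w ∈ words Ω n, μ (wordCylinder Ω w)) atTop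

end Subshift

end SL2Cocycle

/-!
# Generic uniformity of `SL(2, ℝ)` cocycles over Boshernitzan subshifts

Write `logNorm n ω = log ‖A_n(ω)‖` and let `L` be the limit of `sup_ω logNorm n ω / n`.

*Unique ergodicity.* Let `f` depend on finitely many letters and suppose its Birkhoff averages over
`n` steps oscillate by a fixed amount for every `n`. By minimality they pass along one orbit, slowly,
through many separated levels. The words of length comparable to `n` seen just before the first
passage through a level are pairwise distinct, so by the Boshernitzan condition they carry a mass
bounded below, for each level. By the mean ergodic theorem the average hardly changes along such a
word for most of its points, so the sets belonging to different levels are essentially disjoint, and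
there are too many of them (`card_levels_mul_le_one`). Hence Birkhoff averages of continuous
functions converge uniformly (`hasUniformAverages_of_hasLargeWords`).

*The uniform cocycles form a `Gδ` set.* They are the union of the cocycles with `L = 0`, a `Gδ` set
by subadditivity, and of the cocycles which are hyperbolic at some finite scale, an open condition.
Hyperbolicity at a finite scale yields invariant expanding cones, so that `logNorm` is additive up
to a bounded error (`exists_logNorm_superadditive`); `logNorm m / m` is then up to `O(1 / m)` the
Birkhoff average of a continuous function, and unique ergodicity gives uniform convergence.

*They are dense.* Every continuous cocycle is a limit of locally constant ones, and those are uniform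
(`isUniform_of_dependsOnWord`). This is clear if `L = 0`. Otherwise let `l` be a large length for
which all words have measure at least `C / l`. Each word of length comparable to `l` lies in a word
of length `l` without short returns (`exists_word_without_short_returns`; aperiodicity enters here),
so it occurs without overlaps in a fixed proportion of every orbit. If the growth over it were much
smaller than maximal, then by subadditivity the maximal exponent would be smaller than `L`. So the
growth at such scales is nearly maximal at every point, and the cocycle is hyperbolic.
-/

namespace SL2Cocycle

/-! ### The Euclidean action of `SL(2, ℝ)` on the plane -/

/-- The Euclidean plane. -/
abbrev Plane : Type := EuclideanSpace ℝ (Fin 2)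

/-- The linear action of an element of `SL(2, ℝ)` on the Euclidean plane. -/
noncomputable def act (M : SL(2, ℝ)) : Plane →L[ℝ] Plane :=
  Matrix.toEuclideanCLM (𝕜 := ℝ) (M : Matrix (Fin 2) (Fin 2) ℝ)

/-- The signed area of the parallelogram spanned by two vectors of the plane. -/
def wedge (x y : Plane) : ℝ := x 0 * y 1 - x 1 * y 0

/-- Rotation of the plane by a quarter turn. -/
noncomputable def rot (x : Plane) : Plane := !₂[-x 1, x 0]

theorem act_apply_zero (M : SL(2, ℝ)) (x : Plane) : act M x 0 = M 0 0 * x 0 + M 0 1 * x 1 := by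
  have : act M x 0 = ((M : Matrix (Fin 2) (Fin 2) ℝ) *ᵥ x.ofLp) 0 := rfl
  rw [this]; simp [Matrix.mulVec, dotProduct, Fin.sum_univ_two]

theorem act_apply_one (M : SL(2, ℝ)) (x : Plane) : act M x 1 = M 1 0 * x 0 + M 1 1 * x 1 := by
  have : act M x 1 = ((M : Matrix (Fin 2) (Fin 2) ℝ) *ᵥ x.ofLp) 1 := rfl
  rw [this]; simp [Matrix.mulVec, dotProduct, Fin.sum_univ_two]

theorem act_mul (M N : SL(2, ℝ)) (x : Plane) : act (M * N) x = act M (act N x) := by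
  simp [act]

theorem act_one (x : Plane) : act 1 x = x := by
  simp [act]

theorem norm_sq_eq (x : Plane) : ‖x‖ ^ 2 = x 0 ^ 2 + x 1 ^ 2 := by
  rw [EuclideanSpace.real_norm_sq_eq, Fin.sum_univ_two]

theorem wedge_act (M : SL(2, ℝ)) (x y : Plane) : wedge (act M x) (act M y) = wedge x y := by
  have h := M.det_coe
  rw [Matrix.det_fin_two] at h
  simp only [wedge, act_apply_zero, act_apply_one]
  linear_combination (x 0 * y 1 - x 1 * y 0) * h

theorem norm_rot (x : Plane) : ‖rot x‖ = ‖x‖ := by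
  have : ‖rot x‖ ^ 2 = ‖x‖ ^ 2 := by
    rw [norm_sq_eq, norm_sq_eq]; simp [rot]; ring
  exact (sq_eq_sq₀ (norm_nonneg _) (norm_nonneg _)).1 this

theorem inner_eq (x y : Plane) : inner ℝ x y = x 0 * y 0 + x 1 * y 1 := by
  rw [PiLp.inner_apply, Fin.sum_univ_two]; simp; ring

theorem wedge_sq_add_inner_sq (x y : Plane) :
    wedge x y ^ 2 + inner ℝ x y ^ 2 = ‖x‖ ^ 2 * ‖y‖ ^ 2 := by
  rw [norm_sq_eq, norm_sq_eq, inner_eq, wedge]; ring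

theorem abs_wedge_le (x y : Plane) : |wedge x y| ≤ ‖x‖ * ‖y‖ := by
  apply abs_le_of_sq_le_sq _ (by positivity)
  nlinarith [wedge_sq_add_inner_sq x y, sq_nonneg (inner ℝ x y : ℝ)]

theorem wedge_rot (x : Plane) : wedge x (rot x) = ‖x‖ ^ 2 := by
  rw [norm_sq_eq]; simp [wedge, rot]; ring

/-- Expansion of `w` in the orthogonal basis `y`, `rot y`. -/
theorem norm_sq_smul_eq (y w : Plane) :
    (‖y‖ ^ 2) • w = (inner ℝ y w : ℝ) • y + wedge y w • rot y := by
  rw [norm_sq_eq, inner_eq]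
  ext i; fin_cases i <;> simp [wedge, rot] <;> ring

/-- Expansion of `x` in the (possibly oblique) basis `y`, `s`. -/
theorem wedge_smul_eq (x y s : Plane) : wedge y s • x = wedge x s • y + wedge y x • s := by
  ext i; fin_cases i <;> simp [wedge] <;> ring

theorem norm_act_le (M : SL(2, ℝ)) (x : Plane) : ‖act M x‖ ≤ opNorm M * ‖x‖ :=
  (act M).le_opNorm x

theorem opNorm_le {M : SL(2, ℝ)} {c : ℝ} (hc : 0 ≤ c) (h : ∀ x, ‖act M x‖ ≤ c * ‖x‖) :
    opNorm M ≤ c :=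
  (act M).opNorm_le_bound hc h

theorem opNorm_nonneg (M : SL(2, ℝ)) : 0 ≤ opNorm M := norm_nonneg (act M)

theorem opNorm_mul_le (M N : SL(2, ℝ)) : opNorm (M * N) ≤ opNorm M * opNorm N := by
  refine opNorm_le (mul_nonneg (opNorm_nonneg _) (opNorm_nonneg _)) fun x => ?_
  rw [act_mul, mul_assoc]
  exact (norm_act_le _ _).trans
    (mul_le_mul_of_nonneg_left (norm_act_le _ _) (opNorm_nonneg _))

theorem one_le_opNorm (M : SL(2, ℝ)) : 1 ≤ opNorm M := by
  set x : Plane := !₂[1, 0]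
  have hx : ‖x‖ ^ 2 = 1 := by rw [norm_sq_eq]; simp [x]
  have hx1 : ‖x‖ = 1 := by
    rw [← sq_eq_sq₀ (norm_nonneg _) zero_le_one, hx, one_pow]
  have h1 : 1 ≤ ‖act M x‖ * ‖act M (rot x)‖ := by
    have := abs_wedge_le (act M x) (act M (rot x))
    rw [wedge_act, wedge_rot, hx] at this
    simpa using this
  have h2 := norm_act_le M x
  have h3 := norm_act_le M (rot x)
  rw [norm_rot, hx1, mul_one] at h3
  rw [hx1, mul_one] at h2
  by_contra! h
  have := mul_le_mul h2 h3 (norm_nonneg _) (opNorm_nonneg M)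
  nlinarith [opNorm_nonneg M]

theorem opNorm_pos (M : SL(2, ℝ)) : 0 < opNorm M := one_pos.trans_le (one_le_opNorm M)

theorem opNorm_one : opNorm (1 : SL(2, ℝ)) = 1 :=
  le_antisymm (opNorm_le zero_le_one fun x => by rw [act_one, one_mul]) (one_le_opNorm 1)

theorem opNorm_inv_le (M : SL(2, ℝ)) : opNorm M⁻¹ ≤ opNorm M := by
  refine opNorm_le (opNorm_nonneg _) fun x => ?_
  set p := act M⁻¹ x
  have hx : act M p = x := by rw [← act_mul, mul_inv_cancel, act_one]
  have h := abs_wedge_le (act M p) (act M (rot p))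
  rw [wedge_act, wedge_rot, hx, abs_of_nonneg (by positivity)] at h
  have h2 := norm_act_le M (rot p)
  rw [norm_rot] at h2
  have h3 : ‖p‖ * ‖p‖ ≤ (opNorm M * ‖x‖) * ‖p‖ := by
    nlinarith [mul_le_mul_of_nonneg_left h2 (norm_nonneg x)]
  rcases (norm_nonneg p).eq_or_lt with h0 | h0
  · rw [← h0]; exact mul_nonneg (opNorm_nonneg _) (norm_nonneg _)
  · exact le_of_mul_le_mul_right h3 h0

theorem opNorm_inv (M : SL(2, ℝ)) : opNorm M⁻¹ = opNorm M :=
  le_antisymm (opNorm_inv_le M) (by simpa using opNorm_inv_le M⁻¹)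

theorem opNorm_le_mul_left (M N : SL(2, ℝ)) : opNorm N ≤ opNorm M * opNorm (M * N) := by
  have h := opNorm_mul_le M⁻¹ (M * N)
  rwa [inv_mul_cancel_left, opNorm_inv] at h

theorem opNorm_le_mul_right (M N : SL(2, ℝ)) : opNorm M ≤ opNorm (M * N) * opNorm N := by
  have h := opNorm_mul_le (M * N) N⁻¹
  rwa [mul_inv_cancel_right, opNorm_inv] at h

/-- An area-preserving linear map cannot expand every vector. -/
theorem exists_norm_act_le (M : SL(2, ℝ)) : ∃ s : Plane, s ≠ 0 ∧ ‖act M s‖ ≤ ‖s‖ := by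
  have hd := M.det_coe
  rw [Matrix.det_fin_two] at hd
  set a := M 0 0
  set b := M 0 1
  set c := M 1 0
  set d := M 1 1
  have key : ∀ s : Plane, (a * s 0 + b * s 1) ^ 2 + (c * s 0 + d * s 1) ^ 2 ≤ s 0 ^ 2 + s 1 ^ 2 →
      ‖act M s‖ ≤ ‖s‖ := fun s hs => by
    apply le_of_sq_le_sq _ (norm_nonneg _)
    rw [norm_sq_eq, norm_sq_eq, act_apply_zero, act_apply_one]
    exact hs
  rcases le_or_gt (a ^ 2 + c ^ 2) 1 with h | h
  · refine ⟨!₂[1, 0], fun h0 => ?_, key _ ?_⟩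
    · have := congrArg (fun v : Plane => v 0) h0
      simp at this
    · simpa using h
  -- the vector orthogonal to `(1, 0)` for the quadratic form `‖M s‖² - ‖s‖²`; this form is positive
  -- at `(1, 0)` and has non-positive determinant
  · refine ⟨!₂[-(a * b + c * d), a ^ 2 + c ^ 2 - 1], fun h0 => ?_, key _ ?_⟩
    · have := congrArg (fun v : Plane => v 1) h0
      simp at this
      linarith
    · simp only [Matrix.cons_val_zero, Matrix.cons_val_one]
      have e : (a ^ 2 + c ^ 2) * (b ^ 2 + d ^ 2) - (a * b + c * d) ^ 2 = 1 := by
        linear_combination (a * d - b * c + 1) * hd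
      have h2 : 0 ≤ (a ^ 2 + c ^ 2) + (b ^ 2 + d ^ 2) - 2 := by
        nlinarith [sq_nonneg (a - d), sq_nonneg (b + c)]
      have h3 := mul_nonneg (sub_nonneg.2 h.le) h2
      linear_combination h3 + (a ^ 2 + c ^ 2 - 1) * e

/-! ### Expanding cones for products of `SL(2, ℝ)` matrices -/

/-- If `M' M` is almost as large as `‖M'‖ ‖M‖`, then `M` maps vectors which it expands almost
maximally to vectors which `M'` expands almost maximally. -/
theorem cone_step {M M' : SL(2, ℝ)} {κ t : ℝ} {x : Plane} (ht : 0 < t) (hx : x ≠ 0)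
    (hκ : κ * (opNorm M' * opNorm M) ≤ opNorm (M' * M))
    (htκ : 1 ≤ t * (κ - t) * opNorm M ^ 2)
    (hcone : t * opNorm M * ‖x‖ ≤ ‖act M x‖) :
    t * opNorm M' * ‖act M x‖ ≤ ‖act M' (act M x)‖ := by
  set y := act M x with hy
  set σ := opNorm M with hσ
  set σ' := opNorm M' with hσ'
  have hσ0 : 0 < σ := opNorm_pos M
  have hσ0' : 0 < σ' := opNorm_pos M'
  have hx0 : 0 < ‖x‖ := norm_pos_iff.2 hx
  have hy0 : 0 < ‖y‖ := lt_of_lt_of_le (by positivity) hcone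
  set r := ‖act M' y‖ / ‖y‖ with hr
  have hry : ‖act M' y‖ = r * ‖y‖ := by rw [hr, div_mul_cancel₀ _ hy0.ne']
  have hr0 : 0 ≤ r := by positivity
  -- the component of `M z` along `y` is handled by `M' y`, the transverse one by area preservation
  have hbound : opNorm (M' * M) ≤ σ * r + σ' / (t * σ) := by
    refine opNorm_le (by positivity) fun z => ?_
    rw [act_mul]
    set w := act M z with hw
    have h1 : ‖y‖ ^ 2 * ‖act M' w‖ ≤ ‖y‖ * ‖w‖ * ‖act M' y‖ + ‖x‖ * ‖z‖ * (σ' * ‖y‖) := by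
      have e := congrArg (fun v => ‖act M' v‖) (norm_sq_smul_eq y w)
      simp only [map_smul, map_add] at e
      rw [norm_smul, Real.norm_of_nonneg (by positivity)] at e
      rw [e]
      refine (norm_add_le _ _).trans (add_le_add ?_ ?_)
      · rw [norm_smul]
        exact mul_le_mul_of_nonneg_right (abs_real_inner_le_norm y w) (norm_nonneg _)
      · rw [norm_smul, Real.norm_eq_abs, hy, hw, wedge_act, ← hy]
        refine mul_le_mul (abs_wedge_le x z) ?_ (norm_nonneg _) (by positivity)
        exact (norm_act_le M' _).trans_eq (by rw [norm_rot])
    have h2 : ‖w‖ ≤ σ * ‖z‖ := norm_act_le M z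
    have h3 : ‖x‖ ≤ ‖y‖ / (t * σ) := by
      rw [le_div_iff₀ (by positivity)]; linarith
    have h4 : ‖y‖ ^ 2 * ‖act M' w‖ ≤ ‖y‖ ^ 2 * ((σ * r + σ' / (t * σ)) * ‖z‖) := by
      calc _ ≤ ‖y‖ * ‖w‖ * ‖act M' y‖ + ‖x‖ * ‖z‖ * (σ' * ‖y‖) := h1
        _ ≤ ‖y‖ * (σ * ‖z‖) * ‖act M' y‖ + ‖y‖ / (t * σ) * ‖z‖ * (σ' * ‖y‖) := by gcongr
        _ = _ := by rw [hry]; field_simp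
    exact le_of_mul_le_mul_left h4 (by positivity)
  have h5 : κ * (σ' * σ) ≤ σ * r + σ' / (t * σ) := hκ.trans hbound
  have h6 : t * σ' ≤ r := by
    have h7 : σ' / (t * σ) ≤ σ' * (κ - t) * σ := by
      rw [div_le_iff₀ (by positivity)]
      nlinarith
    nlinarith
  rw [hry]
  exact mul_le_mul_of_nonneg_right h6 hy0.le

/-- The product `M_{k-1} ⋯ M_1 M_0`. -/
def seqProd (M : ℕ → SL(2, ℝ)) : ℕ → SL(2, ℝ)
  | 0 => 1
  | k + 1 => M k * seqProd M k

theorem seqProd_add (M : ℕ → SL(2, ℝ)) (j k : ℕ) :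
    seqProd M (j + k) = seqProd (fun i => M (j + i)) k * seqProd M j := by
  induction k with
  | zero => simp [seqProd]
  | succ k ih => rw [← add_assoc, seqProd, ih, seqProd, mul_assoc]

/-- A sequence of matrices in `SL(2, ℝ)` of norm at least `l` such that the norm of the product of
two successive ones is at least `κ` times the product of their norms. The condition `4 < κ * l` is
what makes the cones of vectors expanded by at least `κ / 4` times the norm invariant. -/
structure IsHyperbolicSeq (M : ℕ → SL(2, ℝ)) (κ l : ℝ) : Prop where
  pos : 0 < κ
  large : 4 < κ * l
  le_opNorm : ∀ i, l ≤ opNorm (M i)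
  le_opNorm_mul : ∀ i, κ * (opNorm (M (i + 1)) * opNorm (M i)) ≤ opNorm (M (i + 1) * M i)

namespace IsHyperbolicSeq

variable {M : ℕ → SL(2, ℝ)} {κ l : ℝ}

theorem shift (h : IsHyperbolicSeq M κ l) (j : ℕ) : IsHyperbolicSeq (fun i => M (j + i)) κ l :=
  ⟨h.pos, h.large, fun _ => h.le_opNorm _, fun i => h.le_opNorm_mul (j + i)⟩

theorem le_one (h : IsHyperbolicSeq M κ l) : κ ≤ 1 := by
  have h1 := (h.le_opNorm_mul 0).trans (opNorm_mul_le _ _)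
  have h2 : 0 < opNorm (M (0 + 1)) * opNorm (M 0) := mul_pos (opNorm_pos _) (opNorm_pos _)
  exact le_of_mul_le_mul_right (by rwa [one_mul]) h2

/-- The expanding cones are invariant, and vectors in them are expanded. -/
theorem cone (h : IsHyperbolicSeq M κ l) {t : ℝ} (ht : κ / 4 ≤ t) (ht' : t ≤ κ / 2) {x : Plane}
    (hx : x ≠ 0) (hcone : t * opNorm (M 0) * ‖x‖ ≤ ‖act (M 0) x‖) (k : ℕ) :
    t * opNorm (M k) * ‖act (seqProd M k) x‖ ≤ ‖act (M k) (act (seqProd M k) x)‖ ∧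
      (t * l) ^ k * ‖x‖ ≤ ‖act (seqProd M k) x‖ := by
  have hκ := h.pos
  have hl : 0 < l := by
    by_contra! h0
    nlinarith [h.large]
  have ht0 : 0 < t := by linarith
  have hx0 : 0 < ‖x‖ := norm_pos_iff.2 hx
  induction k with
  | zero => simpa [seqProd, act_one] using hcone
  | succ k ih =>
    obtain ⟨ih1, ih2⟩ := ih
    have hne : act (seqProd M k) x ≠ 0 := by
      rw [← norm_pos_iff]; exact lt_of_lt_of_le (by positivity) ih2
    constructor
    · rw [seqProd, act_mul]
      refine cone_step ht0 hne (h.le_opNorm_mul k) ?_ ih1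
      have h1 : l ^ 2 ≤ opNorm (M k) ^ 2 := pow_le_pow_left₀ hl.le (h.le_opNorm k) 2
      have h2 : κ ^ 2 / 8 ≤ t * (κ - t) := by nlinarith
      have h3 : 16 ≤ κ ^ 2 * l ^ 2 := by nlinarith [h.large]
      nlinarith [mul_le_mul h2 h1 (by positivity) (by nlinarith)]
    · rw [seqProd, act_mul]
      refine le_trans ?_ ih1
      calc (t * l) ^ (k + 1) * ‖x‖ = t * l * ((t * l) ^ k * ‖x‖) := by ring
        _ ≤ t * opNorm (M k) * ‖act (seqProd M k) x‖ :=
          mul_le_mul (mul_le_mul_of_nonneg_left (h.le_opNorm k) ht0.le) ih2 (by positivity)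
            (mul_nonneg ht0.le (opNorm_nonneg _))

/-- Vectors in the narrow cone are expanded by the products at the maximal rate, up to a
constant: a vector that is not expanded lies outside the wide cone, hence at a definite angle
from the narrow one. -/
theorem opNorm_seqProd_le (h : IsHyperbolicSeq M κ l) {y : Plane} (hy : y ≠ 0)
    (hcone : κ / 2 * opNorm (M 0) * ‖y‖ ≤ ‖act (M 0) y‖) (k : ℕ) :
    κ / 12 * opNorm (seqProd M k) * ‖y‖ ≤ ‖act (seqProd M k) y‖ := by
  have hκ := h.pos
  have hκ1 := h.le_one
  have hl : 0 < l := by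
    by_contra! h0
    nlinarith [h.large]
  rcases Nat.eq_zero_or_pos k with rfl | hk
  · simp only [seqProd, opNorm_one, act_one]
    nlinarith [norm_nonneg y]
  wlog hy1 : ‖y‖ = 1 generalizing y
  · have hy0 : 0 < ‖y‖ := norm_pos_iff.2 hy
    have hn : ‖‖y‖⁻¹ • y‖ = 1 := by
      rw [norm_smul, norm_inv, norm_norm, inv_mul_cancel₀ hy0.ne']
    have := this (y := ‖y‖⁻¹ • y) (by simpa using hy) (by
      rw [hn, mul_one, map_smul, norm_smul, norm_inv, norm_norm, ← div_eq_inv_mul,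
        le_div_iff₀ hy0]
      exact hcone) hn
    rwa [hn, mul_one, map_smul, norm_smul, norm_inv, norm_norm, ← div_eq_inv_mul,
        le_div_iff₀ hy0] at this
  set Q := seqProd M k with hQ
  obtain ⟨s, hs0, hs⟩ : ∃ s : Plane, ‖s‖ = 1 ∧ ‖act Q s‖ ≤ 1 := by
    obtain ⟨s, hs, hs'⟩ := exists_norm_act_le Q
    have hs0 : 0 < ‖s‖ := norm_pos_iff.2 hs
    refine ⟨‖s‖⁻¹ • s, ?_, ?_⟩
    · rw [norm_smul, norm_inv, norm_norm, inv_mul_cancel₀ hs0.ne']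
    · rw [map_smul, norm_smul, norm_inv, norm_norm, ← div_eq_inv_mul]
      exact div_le_one_of_le₀ hs' hs0.le
  have hsne : s ≠ 0 := by rw [← norm_pos_iff, hs0]; exact one_pos
  have hQy : 1 ≤ ‖act Q y‖ := by
    have := (h.cone (by linarith) le_rfl hy hcone k).2
    rw [hy1, mul_one] at this
    exact (one_le_pow₀ (by linarith [h.large])).trans this
  have hsout : ‖act (M 0) s‖ < κ / 4 * opNorm (M 0) := by
    by_contra! h0
    have := (h.cone le_rfl (by linarith) hsne (by rw [hs0, mul_one]; exact h0) k).2
    rw [hs0, mul_one] at this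
    have h1 : 1 < (κ / 4 * l) ^ k := one_lt_pow₀ (by linarith [h.large]) hk.ne'
    linarith
  rw [hy1, mul_one] at hcone
  have hpos := opNorm_pos (M 0)
  have hsub : κ / 4 ≤ ‖y - s‖ := by
    have h1 := norm_act_le (M 0) (y - s)
    have h2 := norm_sub_norm_le (act (M 0) y) (act (M 0) s)
    rw [← map_sub] at h2
    nlinarith
  have hadd : κ / 4 ≤ ‖y + s‖ := by
    have h1 := norm_act_le (M 0) (y + s)
    have h2 := norm_sub_norm_le (act (M 0) y) (act (M 0) (-s))
    rw [← map_sub, map_neg, norm_neg, sub_neg_eq_add] at h2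
    nlinarith
  have hi1 := norm_sub_sq_real y s
  have hi2 := norm_add_sq_real y s
  have hw := wedge_sq_add_inner_sq y s
  rw [hy1, hs0] at hi1 hi2 hw
  set i : ℝ := inner ℝ y s
  set v := wedge y s
  have hs2 : (κ / 4) ^ 2 ≤ ‖y - s‖ ^ 2 := pow_le_pow_left₀ (by positivity) hsub 2
  have ha2 : (κ / 4) ^ 2 ≤ ‖y + s‖ ^ 2 := pow_le_pow_left₀ (by positivity) hadd 2
  have hv : κ / 6 ≤ |v| := by
    apply le_of_sq_le_sq _ (abs_nonneg v)
    rw [sq_abs]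
    have h1 : i ≤ 1 - κ ^ 2 / 32 := by nlinarith
    have h2 : -i ≤ 1 - κ ^ 2 / 32 := by nlinarith
    have h3 : i ^ 2 ≤ (1 - κ ^ 2 / 32) := by
      rcases le_total 0 i with h0 | h0 <;> nlinarith
    nlinarith
  have hfin : κ / 6 * opNorm Q ≤ 2 * ‖act Q y‖ := by
    rw [← le_div_iff₀' (by positivity)]
    refine opNorm_le (by positivity) fun x => ?_
    have e := congrArg (fun z => ‖act Q z‖) (wedge_smul_eq x y s)
    simp only [map_smul, map_add] at e
    rw [norm_smul, Real.norm_eq_abs] at e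
    have h1 : |v| * ‖act Q x‖ ≤ ‖x‖ * ‖act Q y‖ + ‖x‖ * 1 := by
      rw [e]
      refine (norm_add_le _ _).trans (add_le_add ?_ ?_)
      · rw [norm_smul, Real.norm_eq_abs]
        have := abs_wedge_le x s
        rw [hs0, mul_one] at this
        exact mul_le_mul_of_nonneg_right this (norm_nonneg _)
      · rw [norm_smul, Real.norm_eq_abs]
        have := abs_wedge_le y x
        rw [hy1, one_mul] at this
        exact mul_le_mul this hs (norm_nonneg _) (norm_nonneg _)
    have h2 := mul_le_mul_of_nonneg_right hv (norm_nonneg (act Q x))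
    have h3 := mul_le_mul_of_nonneg_left hQy (norm_nonneg x)
    rw [div_mul_eq_mul_div, le_div_iff₀ (by positivity)]
    linarith
  rw [hy1, mul_one]
  linarith

/-- The norm of products along a hyperbolic sequence is supermultiplicative up to a constant. -/
theorem le_opNorm_seqProd_add (h : IsHyperbolicSeq M κ l) (j k : ℕ) :
    (κ / 12) ^ 2 * (opNorm (seqProd (fun i => M (j + i)) k) * opNorm (seqProd M j)) ≤
      opNorm (seqProd M (j + k)) := by
  have hκ := h.pos
  have hκ1 := h.le_one
  obtain ⟨x, hx, hcone⟩ : ∃ x : Plane, x ≠ 0 ∧ κ / 2 * opNorm (M 0) * ‖x‖ ≤ ‖act (M 0) x‖ := by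
    by_contra! h0
    have : opNorm (M 0) ≤ κ / 2 * opNorm (M 0) := by
      refine opNorm_le (mul_nonneg (by positivity) (opNorm_nonneg _)) fun x => ?_
      rcases eq_or_ne x 0 with rfl | hx
      · simp
      · exact (h0 x hx).le
    nlinarith [opNorm_pos (M 0)]
  have h1 := h.opNorm_seqProd_le hx hcone j
  have h2 := (h.cone (by linarith) le_rfl hx hcone j).1
  have hx0 : 0 < ‖x‖ := norm_pos_iff.2 hx
  have hne : act (seqProd M j) x ≠ 0 := by
    rw [← norm_pos_iff]
    refine lt_of_lt_of_le ?_ h1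
    have := opNorm_pos (seqProd M j)
    positivity
  have h3 := (h.shift j).opNorm_seqProd_le hne h2 k
  rw [← act_mul, ← seqProd_add] at h3
  have h4 := norm_act_le (seqProd M (j + k)) x
  set q := opNorm (seqProd (fun i => M (j + i)) k)
  have hq : 0 < q := opNorm_pos _
  have h5 : κ / 12 * q * (κ / 12 * opNorm (seqProd M j) * ‖x‖) ≤
      κ / 12 * q * ‖act (seqProd M j) x‖ := mul_le_mul_of_nonneg_left h1 (by positivity)
  refine le_of_mul_le_mul_right ?_ hx0
  linarith

end IsHyperbolicSeq

/-! ### Iterates of cocycles and their growth -/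

section Growth

variable {X : Type*} [TopologicalSpace X] (T : X ≃ₜ X)

theorem iter_add (A : C(X, SL(2, ℝ))) (m n : ℕ) (ω : X) :
    iter T A (m + n) ω = iter T A m (T^[n] ω) * iter T A n ω := by
  induction m with
  | zero => simp [iter]
  | succ m ih =>
    rw [show m + 1 + n = m + n + 1 by ring, iter, ih, iter, mul_assoc,
      Function.iterate_add_apply]

theorem continuous_iterate (n : ℕ) : Continuous (T^[n]) := T.continuous.iterate n

theorem continuous_iter (A : C(X, SL(2, ℝ))) (n : ℕ) : Continuous (iter T A n) := by
  induction n with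
  | zero => exact continuous_const
  | succ n ih => exact (A.continuous.comp (continuous_iterate T n)).mul ih

/-- The `n`-th iterate of a cocycle as a continuous map. -/
def iterMap (n : ℕ) (A : C(X, SL(2, ℝ))) : C(X, SL(2, ℝ)) := ⟨iter T A n, continuous_iter T A n⟩

theorem continuous_iterMap [CompactSpace X] [T2Space X] (n : ℕ) : Continuous (iterMap T n) := by
  refine ContinuousMap.continuous_of_continuous_uncurry _ ?_
  change Continuous fun p : C(X, SL(2, ℝ)) × X => iter T p.1 n p.2
  induction n with
  | zero => exact continuous_const
  | succ n ih =>
    have h : Continuous fun p : C(X, SL(2, ℝ)) × X => p.1 (T^[n] p.2) :=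
      continuous_fst.eval ((continuous_iterate T n).comp continuous_snd)
    exact h.mul ih

theorem continuous_opNorm : Continuous opNorm := by
  have h : Continuous fun M : Matrix (Fin 2) (Fin 2) ℝ => ‖Matrix.toEuclideanCLM (𝕜 := ℝ) M‖ :=
    continuous_norm.comp
      (LinearMap.continuous_of_finiteDimensional
        (Matrix.toEuclideanCLM (n := Fin 2) (𝕜 := ℝ)).toAlgEquiv.toLinearMap)
  exact h.comp continuous_subtype_val

/-- The logarithmic growth `log ‖A_n(ω)‖`. -/
noncomputable def logNorm (A : C(X, SL(2, ℝ))) (n : ℕ) (ω : X) : ℝ :=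
  Real.log (opNorm (iter T A n ω))

variable (A : C(X, SL(2, ℝ)))

theorem logNorm_nonneg (n : ℕ) (ω : X) : 0 ≤ logNorm T A n ω :=
  Real.log_nonneg (one_le_opNorm _)

theorem logNorm_zero (ω : X) : logNorm T A 0 ω = 0 := by simp [logNorm, iter, opNorm_one]

theorem continuous_logNorm (n : ℕ) : Continuous (logNorm T A n) :=
  (continuous_opNorm.comp (continuous_iter T A n)).log fun _ => (opNorm_pos _).ne'

theorem logNorm_add_le (m n : ℕ) (ω : X) :
    logNorm T A (m + n) ω ≤ logNorm T A m (T^[n] ω) + logNorm T A n ω := by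
  rw [logNorm, logNorm, logNorm, ← Real.log_mul (opNorm_pos _).ne' (opNorm_pos _).ne', iter_add]
  exact Real.log_le_log (opNorm_pos _) (opNorm_mul_le _ _)

theorem logNorm_le_logNorm_add_left (m n : ℕ) (ω : X) :
    logNorm T A n ω ≤ logNorm T A m (T^[n] ω) + logNorm T A (m + n) ω := by
  rw [logNorm, logNorm, logNorm, ← Real.log_mul (opNorm_pos _).ne' (opNorm_pos _).ne', iter_add]
  exact Real.log_le_log (opNorm_pos _) (opNorm_le_mul_left _ _)

theorem logNorm_le_logNorm_add_right (m n : ℕ) (ω : X) :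
    logNorm T A m (T^[n] ω) ≤ logNorm T A (m + n) ω + logNorm T A n ω := by
  rw [logNorm, logNorm, logNorm, ← Real.log_mul (opNorm_pos _).ne' (opNorm_pos _).ne', iter_add]
  exact Real.log_le_log (opNorm_pos _) (opNorm_le_mul_right _ _)

theorem logNorm_mul_add_le {R c : ℝ} {n : ℕ} (hR : ∀ k ω, logNorm T A k ω ≤ k * R)
    (hc : ∀ ω, logNorm T A n ω ≤ c) (q r : ℕ) (ω : X) :
    logNorm T A (q * n + r) ω ≤ q * c + r * R := by
  induction q with
  | zero => simpa using hR r ω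
  | succ q ih =>
    rw [show (q + 1) * n + r = n + (q * n + r) by ring]
    refine (logNorm_add_le T A _ _ _).trans ((add_le_add (hc _) ih).trans_eq ?_)
    push_cast; ring

theorem exists_logNorm_le [CompactSpace X] :
    ∃ R : ℝ, 0 ≤ R ∧ ∀ n ω, logNorm T A n ω ≤ n * R := by
  obtain ⟨R, hR⟩ := (isCompact_range (continuous_logNorm T A 1)).bddAbove
  have hR' : ∀ ω, logNorm T A 1 ω ≤ max R 0 := fun ω =>
    (hR (Set.mem_range_self ω)).trans (le_max_left _ _)
  refine ⟨max R 0, le_max_right _ _, fun n ω => ?_⟩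
  induction n with
  | zero => simp [logNorm_zero]
  | succ n ih =>
    rw [add_comm n 1]
    refine (logNorm_add_le T A _ _ _).trans ((add_le_add (hR' _) ih).trans_eq ?_)
    push_cast; ring

/-- Cocycles with subexponential growth, that is, with vanishing (maximal) Lyapunov exponent. -/
def subexponentialSet : Set C(X, SL(2, ℝ)) :=
  {A | ∀ k : ℕ, ∃ n : ℕ, 1 ≤ n ∧ ∀ ω, logNorm T A n ω < n / (k + 1)}

theorem isGδ_subexponentialSet [CompactSpace X] [T2Space X] : IsGδ (subexponentialSet T) := by
  have h : subexponentialSet T = ⋂ k : ℕ, ⋃ n : ℕ, ⋃ (_ : 1 ≤ n),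
      {A | ∀ ω, logNorm T A n ω < n / (k + 1)} := by
    ext A; simp [subexponentialSet]
  rw [h]
  refine IsGδ.iInter_of_isOpen fun k => isOpen_iUnion fun n => isOpen_iUnion fun _ => ?_
  have hU : IsOpen {M : SL(2, ℝ) | Real.log (opNorm M) < n / (k + 1)} :=
    isOpen_lt (continuous_opNorm.log fun M => (opNorm_pos M).ne') continuous_const
  have := (ContinuousMap.isOpen_setOfPred_mapsTo (isCompact_univ (X := X)) hU).preimage
    (continuous_iterMap T n)
  convert this using 1
  ext A
  simp [Set.MapsTo, iterMap, logNorm]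

theorem tendstoUniformly_const_iff {X : Type*} {g : ℕ → X → ℝ} {L : ℝ} :
    TendstoUniformly g (fun _ => L) atTop ↔
      ∀ ε > 0, ∃ N, ∀ n ≥ N, ∀ ω, |g n ω - L| < ε := by
  rw [Metric.tendstoUniformly_iff]
  refine forall₂_congr fun ε _ => ?_
  rw [eventually_atTop]
  simp only [dist_comm L, Real.dist_eq]

theorem isUniform_of_mem_subexponentialSet [CompactSpace X] (hA : A ∈ subexponentialSet T) :
    IsUniform T A := by
  refine ⟨0, tendstoUniformly_const_iff.2 fun ε hε => ?_⟩
  obtain ⟨R, hR0, hR⟩ := exists_logNorm_le T A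
  obtain ⟨k, hk⟩ := exists_nat_one_div_lt (half_pos hε)
  obtain ⟨n, hn, hnA⟩ := hA k
  obtain ⟨N, hN⟩ := exists_nat_gt (2 * (n * R) / ε)
  refine ⟨N + 1, fun t ht ω => ?_⟩
  have ht0 : (0 : ℝ) < t := by exact_mod_cast (by omega : 0 < t)
  have h1 := logNorm_mul_add_le T A hR (fun ω => (hnA ω).le) (t / n) (t % n) ω
  rw [Nat.div_add_mod'] at h1
  have h2 : ((t / n : ℕ) : ℝ) * n ≤ t := by exact_mod_cast Nat.div_mul_le_self t n
  have h3 : ((t % n : ℕ) : ℝ) ≤ n := by exact_mod_cast (Nat.mod_lt t hn).le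
  have h4 : 2 * (n * R) < ε * t := by
    rw [div_lt_iff₀ hε] at hN
    have : (N : ℝ) ≤ t := by exact_mod_cast (by omega : N ≤ t)
    nlinarith
  have h5 : ((t / n : ℕ) : ℝ) * (n / (k + 1)) ≤ t * (ε / 2) := by
    rw [div_eq_mul_one_div, ← mul_assoc]
    exact mul_le_mul h2 hk.le (by positivity) ht0.le
  have h6 : ((t % n : ℕ) : ℝ) * R ≤ n * R := mul_le_mul_of_nonneg_right h3 hR0
  change |1 / (t : ℝ) * logNorm T A t ω - 0| < ε
  rw [sub_zero, abs_of_nonneg (mul_nonneg (by positivity) (logNorm_nonneg _ _ _ _)),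
    one_div, inv_mul_lt_iff₀ ht0]
  nlinarith

/-! ### Almost additive functions and uniform convergence -/

theorem exists_tendstoUniformly_const {X : Type*} {g : ℕ → X → ℝ}
    (h : ∀ ε > 0, ∃ c : ℝ, ∃ N, ∀ n ≥ N, ∀ ω, |g n ω - c| ≤ ε) :
    ∃ L : ℝ, TendstoUniformly g (fun _ => L) atTop := by
  rcases isEmpty_or_nonempty X with hX | ⟨⟨x⟩⟩
  · exact ⟨0, tendstoUniformly_const_iff.2 fun ε _ => ⟨0, fun n _ ω => (hX.false ω).elim⟩⟩
  have hC : CauchySeq fun n => g n x := by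
    rw [Metric.cauchySeq_iff']
    intro ε hε
    obtain ⟨c, N, hN⟩ := h (ε / 3) (by positivity)
    refine ⟨N, fun n hn => ?_⟩
    have h1 := abs_le.1 (hN n hn x)
    have h2 := abs_le.1 (hN N le_rfl x)
    rw [Real.dist_eq, abs_lt]
    constructor <;> linarith
  obtain ⟨L, hL⟩ := cauchySeq_tendsto_of_complete hC
  refine ⟨L, tendstoUniformly_const_iff.2 fun ε hε => ?_⟩
  obtain ⟨c, N, hN⟩ := h (ε / 3) (by positivity)
  refine ⟨N, fun n hn ω => ?_⟩
  have h1 := abs_le.1 (hN n hn ω)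
  have h2 : |L - c| ≤ ε / 3 :=
    le_of_tendsto ((hL.sub_const c).abs) (eventually_atTop.2 ⟨N, fun n hn => hN n hn x⟩)
  have h3 := abs_le.1 h2
  rw [abs_lt]
  constructor <;> linarith

/-- The Birkhoff averages of `f` converge uniformly to a constant. -/
def HasUniformAverages (f : X → ℝ) : Prop :=
  ∃ c : ℝ, TendstoUniformly (fun (n : ℕ) ω => (1 / (n : ℝ)) * birkhoffSum T f n ω)
    (fun _ => c) atTop

/-- If `F` is additive along orbits up to a bounded error, then `F n / n` converges uniformly,
because up to `O(1 / m)` it is the Birkhoff average of `F m / m`. -/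
theorem exists_tendstoUniformly_of_almost_additive {F : ℕ → X → ℝ} {C : ℝ}
    (hb : ∀ n, ∃ R, ∀ ω, |F n ω| ≤ R)
    (hadd : ∀ m n ω, |F (m + n) ω - F m (T^[n] ω) - F n ω| ≤ C)
    (huniq : ∀ n, HasUniformAverages T (F n)) :
    ∃ L : ℝ, TendstoUniformly (fun (n : ℕ) ω => (1 / (n : ℝ)) * F n ω) (fun _ => L) atTop := by
  choose R hR using hb
  refine exists_tendstoUniformly_const fun ε hε => ?_
  obtain ⟨m, hm⟩ := exists_nat_gt (max 1 (3 * C / ε))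
  have hm1 : (1 : ℝ) < m := (le_max_left _ _).trans_lt hm
  have hm0 : (0 : ℝ) < m := by linarith
  have hmC : 3 * C < ε * m := by
    have := (le_max_right _ _).trans_lt hm
    rwa [div_lt_iff₀' hε] at this
  obtain ⟨c, hc⟩ := huniq m
  obtain ⟨N₁, hN₁⟩ := tendstoUniformly_const_iff.1 hc (ε / 3) (by positivity)
  -- the bound for the boundary terms of the telescoping sum
  set B : ℝ := ∑ i ∈ Finset.range m, (C + 2 * R i) with hB
  have key : ∀ (t : ℕ) ω, |birkhoffSum T (F m) t ω - m * F t ω| ≤ t * C + B := by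
    intro t ω
    have h1 : |birkhoffSum T (F m) t ω -
        ∑ i ∈ Finset.range t, (F (m + i) ω - F i ω)| ≤ t * C := by
      rw [birkhoffSum, ← Finset.sum_sub_distrib]
      refine (Finset.abs_sum_le_sum_abs _ _).trans ?_
      refine (Finset.sum_le_card_nsmul _ _ C fun i _ => ?_).trans_eq (by simp)
      rw [abs_sub_comm, sub_right_comm]
      exact hadd m i ω
    have h2 : ∑ i ∈ Finset.range t, (F (m + i) ω - F i ω) =
        ∑ i ∈ Finset.range m, (F (i + t) ω - F i ω) := by
      rw [Finset.sum_sub_distrib, Finset.sum_sub_distrib, sub_eq_sub_iff_add_eq_add]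
      have e1 := Finset.sum_range_add (fun i => F i ω) m t
      have e2 := Finset.sum_range_add (fun i => F i ω) t m
      rw [add_comm t m] at e2
      rw [add_comm _ (∑ i ∈ Finset.range m, F i ω), ← e1, e2, add_comm]
      congr 1
      exact Finset.sum_congr rfl fun i _ => by rw [add_comm]
    have h3 : |∑ i ∈ Finset.range m, (F (i + t) ω - F i ω) - m * F t ω| ≤ B := by
      have e : (m : ℝ) * F t ω = ∑ i ∈ Finset.range m, F t ω := by simp
      rw [e, ← Finset.sum_sub_distrib]
      refine (Finset.abs_sum_le_sum_abs _ _).trans (Finset.sum_le_sum fun i _ => ?_)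
      have a1 := abs_le.1 (hadd i t ω)
      have a2 := abs_le.1 (hR i (T^[t] ω))
      have a3 := abs_le.1 (hR i ω)
      rw [abs_le]
      constructor <;> linarith
    rw [h2] at h1
    have a1 := abs_le.1 h1
    have a3 := abs_le.1 h3
    rw [abs_le]
    constructor <;> linarith
  obtain ⟨N₂, hN₂⟩ := exists_nat_gt (3 * B / ε)
  refine ⟨c / m, max N₁ N₂ + 1, fun t ht ω => ?_⟩
  have ht0 : (0 : ℝ) < t := by exact_mod_cast (by omega : 0 < t)
  have h1 := abs_le.1 (key t ω)
  have h2 := abs_lt.1 (hN₁ t (by omega) ω)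
  have h3 : 3 * B < ε * t := by
    rw [div_lt_iff₀ hε] at hN₂
    have : (N₂ : ℝ) ≤ t := by exact_mod_cast (by omega : N₂ ≤ t)
    nlinarith
  have e : birkhoffSum T (F m) t ω = t * (1 / t * birkhoffSum T (F m) t ω) := by
    field_simp
  set s := 1 / (t : ℝ) * birkhoffSum T (F m) t ω
  have e2 : 1 / (t : ℝ) * F t ω - c / m = (m * F t ω - t * c) / (t * m) := by
    field_simp
  rw [e2, abs_le, le_div_iff₀ (by positivity), div_le_iff₀ (by positivity)]
  rw [e] at h1
  have h4 : ε * t ≤ ε * (t * m) := by nlinarith [mul_pos hε ht0]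
  have h5 : 3 * (t * C) < ε * (t * m) := by nlinarith
  have h6 : t * (s - c) < t * (ε / 3) := mul_lt_mul_of_pos_left h2.2 ht0
  have h7 : t * (-(ε / 3)) < t * (s - c) := mul_lt_mul_of_pos_left h2.1 ht0
  constructor <;> nlinarith

/-! ### Hyperbolic cocycles -/

/-- Cocycles which are hyperbolic at some finite scale `n`: the `n`-th iterates are large, of
comparable norms, and the iterates of length `2 n` are almost as large as the products of the norms
of their halves. Only strict inequalities occur, so the set is open. -/
def hyperbolicSet : Set C(X, SL(2, ℝ)) :=
  {A | ∃ n : ℕ, ∃ l u κ : ℝ, 1 ≤ n ∧ 0 < κ ∧ 4 < κ * l ∧ ∀ ω,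
    (l < opNorm (iter T A n ω) ∧ opNorm (iter T A n ω) < u) ∧
      κ * u ^ 2 < opNorm (iter T A (2 * n) ω)}

theorem isOpen_hyperbolicSet [CompactSpace X] [T2Space X] : IsOpen (hyperbolicSet T) := by
  have h : hyperbolicSet T = ⋃ n : ℕ, ⋃ l : ℝ, ⋃ u : ℝ, ⋃ κ : ℝ,
      ⋃ (_ : 1 ≤ n ∧ 0 < κ ∧ 4 < κ * l),
      iterMap T n ⁻¹' {B | Set.MapsTo B Set.univ {M | l < opNorm M ∧ opNorm M < u}} ∩
      iterMap T (2 * n) ⁻¹' {B | Set.MapsTo B Set.univ {M | κ * u ^ 2 < opNorm M}} := by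
    ext A
    simp only [hyperbolicSet, Set.mem_iUnion, Set.mem_inter_iff, Set.mem_preimage,
      Set.mem_ofPred_eq, Set.MapsTo, Set.mem_univ, true_imp_iff, iterMap, ContinuousMap.coe_mk,
      forall_and, exists_prop, and_assoc]
  rw [h]
  refine isOpen_iUnion fun n => isOpen_iUnion fun l => isOpen_iUnion fun u =>
    isOpen_iUnion fun κ => isOpen_iUnion fun _ => IsOpen.inter ?_ ?_
  · exact (ContinuousMap.isOpen_setOfPred_mapsTo isCompact_univ
      ((isOpen_lt continuous_const continuous_opNorm).inter
        (isOpen_lt continuous_opNorm continuous_const))).preimage (continuous_iterMap T n)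
  · exact (ContinuousMap.isOpen_setOfPred_mapsTo isCompact_univ
      (isOpen_lt continuous_const continuous_opNorm)).preimage (continuous_iterMap T _)

/-- Along a hyperbolic cocycle, `log ‖A_n‖` is superadditive up to a bounded error. -/
theorem exists_logNorm_superadditive [CompactSpace X] (hA : A ∈ hyperbolicSet T) :
    ∃ C : ℝ, ∀ m k ω, logNorm T A m (T^[k] ω) + logNorm T A k ω - C ≤
      logNorm T A (m + k) ω := by
  obtain ⟨n, l, u, κ, hn, hκ, hl, hω⟩ := hA
  obtain ⟨R, hR0, hR⟩ := exists_logNorm_le T A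
  have hprod : ∀ k ω, seqProd (fun i => iter T A n (T^[i * n] ω)) k = iter T A (k * n) ω := by
    intro k ω
    induction k with
    | zero => simp [seqProd, iter]
    | succ k ih => rw [seqProd, ih, add_mul, one_mul, add_comm, iter_add]
  have hseq : ∀ ω, IsHyperbolicSeq (fun i => iter T A n (T^[i * n] ω)) κ l := by
    refine fun ω => ⟨hκ, hl, fun i => (hω _).1.1.le, fun i => ?_⟩
    have h1 := (hω (T^[i * n] ω)).2
    have h2 := (hω (T^[i * n] ω)).1.2
    have h3 := (hω (T^[(i + 1) * n] ω)).1.2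
    have e : T^[(i + 1) * n] ω = T^[n] (T^[i * n] ω) := by
      rw [← Function.iterate_add_apply]; congr 1; ring
    rw [two_mul, iter_add, ← e] at h1
    refine le_trans ?_ h1.le
    rw [sq]
    exact mul_le_mul_of_nonneg_left
      (mul_le_mul h3.le h2.le (opNorm_nonneg _) ((opNorm_nonneg _).trans h3.le)) hκ.le
  set c := Real.log ((κ / 12) ^ 2) with hc
  have hmul : ∀ p q ω, c + (logNorm T A (q * n) (T^[p * n] ω) + logNorm T A (p * n) ω) ≤
      logNorm T A (q * n + p * n) ω := by
    intro p q ω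
    have h := (hseq ω).le_opNorm_seqProd_add p q
    have e : (fun i => iter T A n (T^[(p + i) * n] ω)) =
        fun i => iter T A n (T^[i * n] (T^[p * n] ω)) := by
      funext i
      rw [← Function.iterate_add_apply]; congr 2; ring
    simp only [e, hprod] at h
    have h' := Real.log_le_log (mul_pos (by positivity)
      (mul_pos (opNorm_pos _) (opNorm_pos _))) h
    rw [Real.log_mul (by positivity) (mul_pos (opNorm_pos _) (opNorm_pos _)).ne',
      Real.log_mul (opNorm_pos _).ne' (opNorm_pos _).ne'] at h'
    rw [← add_mul, add_comm q p]
    exact h'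
  refine ⟨6 * (n * R) - c, fun m k ω => ?_⟩
  -- round both lengths down to multiples of `n`
  set p := k / n
  set s := k % n
  set q := m / n
  set r := m % n
  have hk : s + p * n = k := by rw [add_comm]; exact Nat.div_add_mod' k n
  have hm : r + q * n = m := by rw [add_comm]; exact Nat.div_add_mod' m n
  have hle : ∀ j < n, ∀ ω, logNorm T A j ω ≤ n * R := fun j hj ω =>
    (hR j ω).trans (mul_le_mul_of_nonneg_right (by exact_mod_cast hj.le) hR0)
  have hs := hle s (Nat.mod_lt k hn)
  have hr := hle r (Nat.mod_lt m hn)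
  have h1 := hmul p q ω
  -- replace `k` by `p n`
  have h2 := logNorm_add_le T A s (p * n) ω
  have h3 := logNorm_le_logNorm_add_right T A m s (T^[p * n] ω)
  rw [← Function.iterate_add_apply, hk] at h3
  rw [hk] at h2
  -- replace `m` by `q n`
  have h4 := logNorm_add_le T A (s + r) (q * n) (T^[p * n] ω)
  rw [show s + r + q * n = m + s by omega] at h4
  have h5 := logNorm_add_le T A s r (T^[q * n] (T^[p * n] ω))
  have h6 := logNorm_le_logNorm_add_left T A (s + r) (q * n + p * n) ω
  rw [show s + r + (q * n + p * n) = m + k by omega] at h6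
  have h7 := logNorm_add_le T A s r (T^[q * n + p * n] ω)
  linarith [hs (T^[p * n] ω), hs (T^[r] (T^[q * n] (T^[p * n] ω))), hr (T^[q * n] (T^[p * n] ω)),
    hs (T^[r] (T^[q * n + p * n] ω)), hr (T^[q * n + p * n] ω)]

theorem isUniform_of_mem_hyperbolicSet [CompactSpace X]
    (huniq : ∀ f : C(X, ℝ), HasUniformAverages T f) (hA : A ∈ hyperbolicSet T) :
    IsUniform T A := by
  obtain ⟨C, hC⟩ := exists_logNorm_superadditive T A hA
  obtain ⟨R, hR0, hR⟩ := exists_logNorm_le T A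
  refine exists_tendstoUniformly_of_almost_additive T (C := max C 0)
    (fun n => ⟨n * R, fun ω => ?_⟩) (fun m n ω => ?_)
    (fun n => huniq ⟨logNorm T A n, continuous_logNorm T A n⟩)
  · exact (abs_of_nonneg (logNorm_nonneg T A n ω)).trans_le (hR n ω)
  · have h1 := hC m n ω
    have h2 := logNorm_add_le T A m n ω
    have h3 := le_max_left C 0
    have h4 := le_max_right C 0
    change |logNorm T A (m + n) ω - logNorm T A m (T^[n] ω) - logNorm T A n ω| ≤ _
    rw [abs_le]
    constructor <;> linarith

/-- Two-sided bounds on the growth at a large scale and its double imply hyperbolicity. -/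
theorem mem_hyperbolicSet_of_bounds {L δ : ℝ} {n : ℕ} (hn : 1 ≤ n) (hδ : 0 < δ)
    (hlarge : 2 ≤ n * (L - 10 * δ))
    (hlow : ∀ ω, n * (L - δ) ≤ logNorm T A n ω) (hup : ∀ ω, logNorm T A n ω ≤ n * (L + δ))
    (hlow2 : ∀ ω, (2 * n) * (L - δ) ≤ logNorm T A (2 * n) ω) : A ∈ hyperbolicSet T := by
  have hn0 : (0 : ℝ) < n := by exact_mod_cast hn
  have hnδ : 0 < n * δ := by positivity
  refine ⟨n, Real.exp (n * (L - 2 * δ)), Real.exp (n * (L + 2 * δ)), Real.exp (-(8 * n * δ)), hn,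
    Real.exp_pos _, ?_, fun ω => ⟨⟨?_, ?_⟩, ?_⟩⟩
  · rw [← Real.exp_add]
    have h1 : Real.exp 2 ≤ Real.exp (-(8 * n * δ) + n * (L - 2 * δ)) := by
      apply Real.exp_le_exp.2; linarith
    have h2 : Real.exp 2 = Real.exp 1 * Real.exp 1 := by rw [← Real.exp_add]; norm_num
    nlinarith [Real.exp_one_gt_d9]
  · rw [← Real.lt_log_iff_exp_lt (opNorm_pos _)]
    exact lt_of_lt_of_le (by linarith) (hlow ω)
  · rw [← Real.log_lt_iff_lt_exp (opNorm_pos _)]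
    exact (hup ω).trans_lt (by linarith)
  · rw [← Real.exp_nat_mul, ← Real.exp_add, ← Real.lt_log_iff_exp_lt (opNorm_pos _)]
    refine lt_of_lt_of_le ?_ (hlow2 ω)
    push_cast
    linarith

theorem mem_union_of_isUniform (hA : IsUniform T A) :
    A ∈ subexponentialSet T ∪ hyperbolicSet T := by
  obtain ⟨L, hL⟩ := hA
  have hL' : ∀ ε > 0, ∃ N, ∀ n ≥ N, 1 ≤ n → ∀ ω, n * (L - ε) ≤ logNorm T A n ω ∧
      logNorm T A n ω < n * (L + ε) := by
    intro ε hε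
    obtain ⟨N, hN⟩ := tendstoUniformly_const_iff.1 hL ε hε
    refine ⟨N, fun n hn hn1 ω => ?_⟩
    have hn0 : (0 : ℝ) < n := by exact_mod_cast hn1
    have h : |1 / (n : ℝ) * logNorm T A n ω - L| < ε := hN n hn ω
    have h1 := abs_lt.1 h
    have e : logNorm T A n ω = n * (1 / (n : ℝ) * logNorm T A n ω) := by field_simp
    rw [e]
    constructor
    · exact mul_le_mul_of_nonneg_left (by linarith) hn0.le
    · exact mul_lt_mul_of_pos_left (by linarith) hn0
  rcases le_or_gt L 0 with h0 | h0
  · left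
    intro k
    obtain ⟨N, hN⟩ := hL' (1 / (k + 1)) (by positivity)
    refine ⟨N + 1, by omega, fun ω => ?_⟩
    have h1 := (hN (N + 1) (by omega) (by omega) ω).2
    refine h1.trans_le ?_
    rw [div_eq_mul_one_div ((N + 1 : ℕ) : ℝ)]
    exact mul_le_mul_of_nonneg_left (add_le_of_nonpos_left h0) (by positivity)
  · right
    obtain ⟨N, hN⟩ := hL' (L / 20) (by positivity)
    obtain ⟨N', hN'⟩ := exists_nat_gt (4 / L)
    have h1 : ((N + N' + 1 : ℕ) : ℝ) * L ≥ 4 := by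
      rw [div_lt_iff₀ h0] at hN'
      push_cast
      nlinarith
    refine mem_hyperbolicSet_of_bounds T A (L := L) (δ := L / 20) (n := N + N' + 1) (by omega)
      (by positivity) (by linarith) (fun ω => (hN _ (by omega) (by omega) ω).1)
      (fun ω => (hN _ (by omega) (by omega) ω).2.le) (fun ω => ?_)
    have := (hN (2 * (N + N' + 1)) (by omega) (by omega) ω).1
    push_cast at this ⊢
    exact this

theorem setOf_isUniform_eq [CompactSpace X] (huniq : ∀ f : C(X, ℝ), HasUniformAverages T f) :
    {A | IsUniform T A} = subexponentialSet T ∪ hyperbolicSet T := by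
  ext A
  refine ⟨mem_union_of_isUniform T A, ?_⟩
  rintro (h | h)
  · exact isUniform_of_mem_subexponentialSet T A h
  · exact isUniform_of_mem_hyperbolicSet T A huniq h

/-- Over a uniquely ergodic homeomorphism the uniform cocycles form a `Gδ` set. -/
theorem isGδ_setOf_isUniform [CompactSpace X] [T2Space X]
    (huniq : ∀ f : C(X, ℝ), HasUniformAverages T f) :
    IsGδ {A : C(X, SL(2, ℝ)) | IsUniform T A} := by
  rw [setOf_isUniform_eq T huniq]
  exact (isGδ_subexponentialSet T).union (isOpen_hyperbolicSet T).isGδ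

end Growth

/-! ### Birkhoff sums -/

section Birkhoff

/-- By the mean ergodic theorem, Birkhoff averages over long blocks do not change much along
the orbit of most points. -/
theorem exists_measure_birkhoffSum_iterate_le {X : Type*} [MeasurableSpace X] {μ : Measure X}
    [IsProbabilityMeasure μ] {T : X → X} (hT : MeasurePreserving T μ μ) {f : X → ℝ}
    (hf : Measurable f) {R : ℝ} (hR : ∀ x, |f x| ≤ R) {δ η : ℝ} (hδ : 0 < δ) (hη : 0 < η) :
    ∃ N : ℕ, ∀ n ≥ N, ∀ j : ℕ,
      μ.real {x | δ * n < |birkhoffSum T f n (T^[j] x) - birkhoffSum T f n x|} ≤ η := by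
  have hfL : MemLp f 2 μ :=
    MemLp.of_bound hf.aestronglyMeasurable R (Eventually.of_forall fun x => hR x)
  set F : Lp ℝ 2 μ := hfL.toLp f
  set U : Lp ℝ 2 μ →L[ℝ] Lp ℝ 2 μ :=
    (Lp.compMeasurePreservingₗᵢ ℝ T hT).toContinuousLinearMap with hU
  have hUiso : ∀ g, ‖U g‖ = ‖g‖ := (Lp.compMeasurePreservingₗᵢ ℝ T hT).norm_map
  have hUn : ‖U‖ ≤ 1 := U.opNorm_le_bound zero_le_one fun g => by rw [hUiso, one_mul]
  have hUtoLp : ∀ {g : X → ℝ} (hg : MemLp g 2 μ) (j : ℕ),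
      U^[j] (hg.toLp g) = (hg.comp_measurePreserving (hT.iterate j)).toLp (g ∘ T^[j]) := by
    intro g hg j
    have : (U : Lp ℝ 2 μ → Lp ℝ 2 μ) = Lp.compMeasurePreserving T hT := rfl
    rw [this, Lp.compMeasurePreserving_iterate, Lp.toLp_compMeasurePreserving]
  have hUF : ∀ j : ℕ, U^[j] F = _ := hUtoLp hfL
  have hSm : ∀ n, MemLp (birkhoffSum T f n) 2 μ ∧ ∀ h : MemLp (birkhoffSum T f n) 2 μ,
      h.toLp _ = ∑ i ∈ Finset.range n, U^[i] F := by
    intro n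
    induction n with
    | zero =>
      have e : birkhoffSum T f 0 = 0 := by funext x; simp [birkhoffSum]
      refine ⟨by rw [e]; exact MemLp.zero, fun h => ?_⟩
      rw [Finset.range_zero, Finset.sum_empty, ← MemLp.toLp_zero (E := ℝ) (μ := μ) (p := 2)
        MemLp.zero]
      exact MemLp.toLp_congr _ _ (by rw [e])
    | succ n ih =>
      have e : birkhoffSum T f (n + 1) = birkhoffSum T f n + f ∘ T^[n] := by
        funext x; simp [birkhoffSum, Finset.sum_range_succ]
      have h2 := hfL.comp_measurePreserving (hT.iterate n)
      refine ⟨by rw [e]; exact ih.1.add h2, fun h => ?_⟩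
      rw [Finset.sum_range_succ, ← ih.2 ih.1, hUF, ← MemLp.toLp_add ih.1 h2]
      exact MemLp.toLp_congr _ _ (by rw [e])
  obtain ⟨P, hPfix, hP⟩ : ∃ P : Lp ℝ 2 μ, U P = P ∧
      Tendsto (birkhoffAverage ℝ U id · F) atTop (𝓝 P) := by
    refine ⟨_, ?_, U.tendsto_birkhoffAverage_orthogonalProjection hUn F⟩
    exact LinearMap.mem_eqLocus.1 (SetLike.coe_mem _)
  have hUj : ∀ (j : ℕ) g h, ‖U^[j] g - U^[j] h‖ = ‖g - h‖ := by
    intro j g h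
    induction j with
    | zero => rfl
    | succ j ih =>
      rw [Function.iterate_succ_apply', Function.iterate_succ_apply', ← map_sub, hUiso, ih]
  have hPj : ∀ j : ℕ, U^[j] P = P := fun j => Function.iterate_fixed hPfix j
  have hε : 0 < δ * √η / 2 := by positivity
  obtain ⟨N, hN⟩ := Metric.tendsto_atTop.1 hP _ hε
  refine ⟨N + 1, fun n hn j => ?_⟩
  have hn0 : (0 : ℝ) < n := by exact_mod_cast (by omega : 0 < n)
  have hV := (hSm n).1
  have hVj := hV.comp_measurePreserving (hT.iterate j)
  set V := hV.toLp _ with hVdef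
  have hVeq : V = (n : ℝ) • birkhoffAverage ℝ U id n F := by
    rw [hVdef, (hSm n).2 hV, birkhoffAverage, smul_smul, mul_inv_cancel₀ hn0.ne', one_smul]
    rfl
  have hVP : ‖V - (n : ℝ) • P‖ ≤ n * (δ * √η / 2) := by
    rw [hVeq, ← smul_sub, norm_smul, Real.norm_of_nonneg hn0.le]
    have := hN n (by omega)
    rw [dist_eq_norm] at this
    exact mul_le_mul_of_nonneg_left this.le hn0.le
  have hdiff : ‖U^[j] V - V‖ ≤ n * δ * √η := by
    have hnP : U^[j] ((n : ℝ) • P) = (n : ℝ) • P := by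
      apply Function.iterate_fixed
      rw [map_smul, hPfix]
    have h1 : ‖U^[j] V - (n : ℝ) • P‖ ≤ n * (δ * √η / 2) := by
      conv_lhs => rw [← hnP, hUj]
      exact hVP
    have := norm_sub_le_norm_sub_add_norm_sub (U^[j] V) ((n : ℝ) • P) V
    rw [norm_sub_rev ((n : ℝ) • P) V] at this
    linarith
  rw [hVdef, hUtoLp hV j, ← MemLp.toLp_sub hVj hV, Lp.norm_toLp] at hdiff
  set h := birkhoffSum T f n ∘ T^[j] - birkhoffSum T f n with hh
  have hhL : MemLp h 2 μ := hVj.sub hV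
  have hcheb := mul_meas_ge_le_pow_eLpNorm' μ (p := 2) two_ne_zero ENNReal.ofNat_ne_top
    hhL.aestronglyMeasurable (ENNReal.ofReal (δ * n))
  have h2 := ENNReal.toReal_mono
    (ENNReal.rpow_ne_top_of_nonneg (by norm_num) hhL.eLpNorm_ne_top) hcheb
  rw [ENNReal.toReal_mul, ← ENNReal.toReal_rpow, ← ENNReal.toReal_rpow,
    ENNReal.toReal_ofReal (by positivity)] at h2
  simp only [ENNReal.toReal_ofNat, Real.rpow_ofNat] at h2
  have h3 : (eLpNorm h 2 μ).toReal ^ 2 ≤ (n * δ * √η) ^ 2 :=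
    pow_le_pow_left₀ ENNReal.toReal_nonneg hdiff 2
  rw [mul_pow, Real.sq_sqrt hη.le] at h3
  have hsub : {x | δ * n < |birkhoffSum T f n (T^[j] x) - birkhoffSum T f n x|} ⊆
      {x | ENNReal.ofReal (δ * n) ≤ ‖h x‖ₑ} := by
    intro x hx
    have hx' : δ * n < ‖h x‖ := hx
    change ENNReal.ofReal (δ * n) ≤ ‖h x‖ₑ
    rw [← ofReal_norm]
    exact ENNReal.ofReal_le_ofReal hx'.le
  refine (measureReal_mono hsub).trans ?_
  refine le_of_mul_le_mul_left (a := (δ * n) ^ 2) ?_ (by positivity)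
  exact (h2.trans h3).trans_eq (by ring)

variable {X : Type*} {T : X → X} {f : X → ℝ} {R : ℝ}

theorem abs_birkhoffSum_le (hR : ∀ x, |f x| ≤ R) (n : ℕ) (x : X) :
    |birkhoffSum T f n x| ≤ n * R := by
  refine (Finset.abs_sum_le_sum_abs _ _).trans ?_
  refine (Finset.sum_le_card_nsmul _ _ R fun i _ => hR _).trans_eq (by simp)

theorem abs_birkhoffSum_iterate_sub_le (hR : ∀ x, |f x| ≤ R) (n j : ℕ) (x : X) :
    |birkhoffSum T f n (T^[j] x) - birkhoffSum T f n x| ≤ 2 * R * j := by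
  have h1 := birkhoffSum_add T f j n x
  have h2 := birkhoffSum_add T f n j x
  rw [add_comm j n, h2] at h1
  have e : birkhoffSum T f n (T^[j] x) - birkhoffSum T f n x =
      birkhoffSum T f j (T^[n] x) - birkhoffSum T f j x := by linarith
  have h3 := abs_le.1 (abs_birkhoffSum_le (T := T) hR j (T^[n] x))
  have h4 := abs_le.1 (abs_birkhoffSum_le (T := T) hR j x)
  rw [e, abs_le]
  constructor <;> linarith

/-- The oscillation of some Birkhoff average of `f` is as small as desired. -/
def HasSmallOscillation (T : X → X) (f : X → ℝ) : Prop :=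
  ∀ ε > 0, ∃ n : ℕ, 1 ≤ n ∧ ∀ x y, |birkhoffSum T f n x - birkhoffSum T f n y| ≤ ε * n

theorem HasSmallOscillation.of_comp_iterate {k : ℕ} (h : HasSmallOscillation T (f ∘ T^[k]))
    (hT : Function.Surjective T) : HasSmallOscillation T f := by
  intro ε hε
  obtain ⟨n, hn, hosc⟩ := h ε hε
  refine ⟨n, hn, fun x y => ?_⟩
  have e : ∀ x, birkhoffSum T (f ∘ T^[k]) n x = birkhoffSum T f n (T^[k] x) := fun x =>
    Finset.sum_congr rfl fun i _ => by
      simp only [Function.comp_apply, ← Function.iterate_add_apply, add_comm]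
  obtain ⟨x, rfl⟩ := hT.iterate k x
  obtain ⟨y, rfl⟩ := hT.iterate k y
  rw [← e, ← e]
  exact hosc _ _

theorem HasSmallOscillation.of_approx
    (h : ∀ ε > 0, ∃ g, HasSmallOscillation T g ∧ ∀ x, |f x - g x| ≤ ε) :
    HasSmallOscillation T f := by
  intro ε hε
  obtain ⟨g, hg, hfg⟩ := h (ε / 3) (by positivity)
  obtain ⟨n, hn, hosc⟩ := hg (ε / 3) (by positivity)
  refine ⟨n, hn, fun x y => ?_⟩
  have h1 : ∀ x, |birkhoffSum T f n x - birkhoffSum T g n x| ≤ n * (ε / 3) := fun x => by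
    have := abs_birkhoffSum_le (T := T) (f := fun x => f x - g x) hfg n x
    rwa [birkhoffSum, Finset.sum_sub_distrib] at this
  have a1 := abs_le.1 (h1 x)
  have a2 := abs_le.1 (h1 y)
  have a3 := abs_le.1 (hosc x y)
  rw [abs_le]
  constructor <;> linarith

end Birkhoff

section Topological

variable {X : Type*} [TopologicalSpace X] {T : X ≃ₜ X}

theorem HasSmallOscillation.hasUniformAverages {f : X → ℝ} (h : HasSmallOscillation T f)
    {R : ℝ} (hR : ∀ x, |f x| ≤ R) : HasUniformAverages T f := by
  refine exists_tendstoUniformly_const fun ε hε => ?_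
  rcases isEmpty_or_nonempty X with hX | ⟨⟨x₀⟩⟩
  · exact ⟨0, 0, fun n _ ω => (hX.false ω).elim⟩
  have hR0 : 0 ≤ R := (abs_nonneg _).trans (hR x₀)
  obtain ⟨n, hn, hosc⟩ := h (ε / 2) (by positivity)
  have hn0 : (0 : ℝ) < n := by exact_mod_cast hn
  set a := birkhoffSum T f n x₀
  have ha : |a| ≤ n * R := abs_birkhoffSum_le hR n x₀
  obtain ⟨N, hN⟩ := exists_nat_gt (2 * (2 * n * R) / ε)
  refine ⟨a / n, N + 1, fun t ht ω => ?_⟩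
  have ht0 : (0 : ℝ) < t := by exact_mod_cast (by omega : 0 < t)
  have hq : ∀ q : ℕ, |birkhoffSum T f (q * n) ω - q * a| ≤ q * (ε / 2 * n) := by
    intro q
    induction q with
    | zero => simp [birkhoffSum]
    | succ q ih =>
      rw [add_mul, one_mul, birkhoffSum_add]
      have a1 := abs_le.1 ih
      have a2 := abs_le.1 (hosc (T^[q * n] ω) x₀)
      push_cast
      rw [abs_le]
      constructor <;> linarith
  have h1 := abs_le.1 (hq (t / n))
  have h2 := abs_le.1 (abs_birkhoffSum_le (T := T) hR (t % n) (T^[t / n * n] ω))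
  have h3 := birkhoffSum_add T f (t / n * n) (t % n) ω
  rw [Nat.div_add_mod'] at h3
  have h4 : ((t / n : ℕ) : ℝ) * n + ((t % n : ℕ) : ℝ) = t := by exact_mod_cast Nat.div_add_mod' t n
  have h5 : ((t % n : ℕ) : ℝ) ≤ n := by exact_mod_cast (Nat.mod_lt t hn).le
  have h6 : ((t % n : ℕ) : ℝ) * R ≤ n * R := mul_le_mul_of_nonneg_right h5 hR0
  have h7 : 2 * (2 * n * R) < ε * t := by
    rw [div_lt_iff₀ hε] at hN
    have : (N : ℝ) ≤ t := by exact_mod_cast (by omega : N ≤ t)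
    nlinarith
  set q : ℝ := ((t / n : ℕ) : ℝ)
  set r : ℝ := ((t % n : ℕ) : ℝ)
  have hr0 : 0 ≤ r := Nat.cast_nonneg _
  have h8 : |r * (a / n)| ≤ n * R := by
    rw [abs_mul, abs_of_nonneg hr0, abs_div, abs_of_pos hn0]
    have : |a| / n ≤ R := by rw [div_le_iff₀ hn0]; linarith
    exact (mul_le_mul h5 this (by positivity) hn0.le)
  have h9 := abs_le.1 h8
  have e : (t : ℝ) * (a / n) = q * a + r * (a / n) := by
    rw [← h4]; field_simp
  have h10 : q * (ε / 2 * n) ≤ ε / 2 * t := by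
    rw [← h4]; nlinarith
  have e2 : 1 / (t : ℝ) * birkhoffSum T f t ω - a / n =
      (birkhoffSum T f t ω - t * (a / n)) / t := by field_simp
  rw [e2, abs_le, le_div_iff₀ ht0, div_le_iff₀ ht0, e, h3]
  constructor <;> linarith

theorem zpow_add_natCast_apply (T : X ≃ₜ X) (n : ℤ) (N : ℕ) (h : 0 ≤ n + N) (x : X) :
    (T ^ n) (T^[N] x) = T^[(n + N).toNat] x := by
  have hp : ∀ (k : ℕ) x, (T ^ k) x = T^[k] x := by
    intro k
    induction k with
    | zero => intro x; rfl
    | succ k ih =>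
      intro x
      rw [pow_succ, Homeomorph.mul_apply, ih, Function.iterate_succ_apply]
  rw [← hp, ← hp, ← zpow_natCast, ← Homeomorph.mul_apply, ← zpow_add, ← zpow_natCast,
    Int.toNat_of_nonneg h]

/-- Over a compact space, the forward orbits of a minimal homeomorphism are dense. -/
theorem IsMinimal.exists_iterate_mem [CompactSpace X] (hT : IsMinimal T) {U : Set X}
    (hU : IsOpen U) (hne : U.Nonempty) (x : X) : ∃ k : ℕ, T^[k] x ∈ U := by
  obtain ⟨t, ht⟩ := isCompact_univ.elim_finite_subcover (fun n : ℤ => (T ^ n) ⁻¹' U)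
    (fun n => hU.preimage (T ^ n).continuous) (fun y _ => by
      obtain ⟨_, hz, n, rfl⟩ := (hT y).inter_open_nonempty U hU hne
      exact Set.mem_iUnion.2 ⟨n, hz⟩)
  obtain ⟨N, hN⟩ : ∃ N : ℕ, ∀ n ∈ t, 0 ≤ n + (N : ℤ) := by
    refine ⟨∑ n ∈ t, n.natAbs, fun n hn => ?_⟩
    have := Finset.single_le_sum (f := Int.natAbs) (fun _ _ => Nat.zero_le _) hn
    omega
  obtain ⟨n, hn, hx⟩ := Set.mem_iUnion₂.1 (ht (Set.mem_univ (T^[N] x)))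
  exact ⟨(n + N).toNat, by rw [← zpow_add_natCast_apply T n N (hN n hn)]; exact hx⟩

end Topological

/-! ### Words and locally constant functions on subshifts -/

section Words

variable {𝓐 : Type*} [TopologicalSpace 𝓐] (Ω : Subshift 𝓐 ℤ)

theorem shiftHomeo_iterate_apply (n : ℕ) (ω : Ω.carrier) (k : ℤ) :
    ((shiftHomeo Ω)^[n] ω).1 k = ω.1 (k + n) := by
  induction n generalizing ω with
  | zero => simp
  | succ n ih =>
    rw [Function.iterate_succ_apply, ih]
    change ω.1 (k + n + 1) = _
    exact congrArg ω.1 (by push_cast; ring)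

theorem word_eq_iff {𝓐 : Type*} {n : ℕ} {ω ω' : ℤ → 𝓐} :
    word n ω = word n ω' ↔ ∀ i : ℤ, 1 ≤ i → i ≤ n → ω i = ω' i := by
  constructor
  · intro h i h1 h2
    have := congrFun h ⟨(i - 1).toNat, by omega⟩
    simp only [word] at this
    rwa [Int.toNat_of_nonneg (by omega), sub_add_cancel] at this
  · intro h
    funext i
    exact h _ (by omega) (by have := i.2; omega)

theorem word_iterate_eq {n m k : ℕ} (h : k + m ≤ n) {ω ω' : Ω.carrier}
    (hω : word n ω.1 = word n ω'.1) :
    word m ((shiftHomeo Ω)^[k] ω).1 = word m ((shiftHomeo Ω)^[k] ω').1 := by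
  rw [word_eq_iff] at hω ⊢
  intro i h1 h2
  rw [shiftHomeo_iterate_apply, shiftHomeo_iterate_apply]
  exact hω _ (by omega) (by omega)

/-- A function on a subshift depends only on the word `ω₁ … ω_M`. -/
def DependsOnWord {Y : Type*} (M : ℕ) (f : Ω.carrier → Y) : Prop :=
  ∀ ω ω' : Ω.carrier, word M ω.1 = word M ω'.1 → f ω = f ω'

variable {Ω}

theorem DependsOnWord.birkhoffSum_eq {M : ℕ} {f : Ω.carrier → ℝ} (hf : DependsOnWord Ω M f)
    {l n k : ℕ} (h : k + n + M ≤ l) {ω ω' : Ω.carrier} (hω : word l ω.1 = word l ω'.1) :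
    birkhoffSum (shiftHomeo Ω) f n ((shiftHomeo Ω)^[k] ω) =
      birkhoffSum (shiftHomeo Ω) f n ((shiftHomeo Ω)^[k] ω') := by
  refine Finset.sum_congr rfl fun i hi => hf _ _ ?_
  rw [Finset.mem_range] at hi
  rw [← Function.iterate_add_apply, ← Function.iterate_add_apply]
  exact word_iterate_eq Ω (by omega) hω

theorem DependsOnWord.iter_eq {M : ℕ} {A : C(Ω.carrier, SL(2, ℝ))} (hA : DependsOnWord Ω M A)
    {n : ℕ} {ω ω' : Ω.carrier} (hω : word (n + M) ω.1 = word (n + M) ω'.1) :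
    iter (shiftHomeo Ω) A n ω = iter (shiftHomeo Ω) A n ω' := by
  induction n with
  | zero => rfl
  | succ n ih =>
    have h0 := word_iterate_eq Ω (m := n + M) (k := 0) (by omega) hω
    rw [iter, iter, ih h0, hA _ _ (word_iterate_eq Ω (by omega) hω)]

instance [Finite 𝓐] : CompactSpace Ω.carrier :=
  isCompact_iff_compactSpace.1 Ω.isClosed.isCompact

theorem isClopen_setOf_word_eq [DiscreteTopology 𝓐] (n : ℕ) (w : Fin n → 𝓐) :
    IsClopen {ω : Ω.carrier | word n ω.1 = w} := by
  have h : Continuous fun ω : Ω.carrier => word n ω.1 :=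
    continuous_pi fun i => (continuous_apply _).comp continuous_subtype_val
  exact (isClopen_discrete {w}).preimage h

theorem DependsOnWord.continuous [DiscreteTopology 𝓐] {Y : Type*} [TopologicalSpace Y] {M : ℕ}
    {f : Ω.carrier → Y} (hf : DependsOnWord Ω M f) : Continuous f := by
  refine IsLocallyConstant.continuous ((IsLocallyConstant.iff_exists_open f).2 fun ω =>
    ⟨{ω' | word M ω'.1 = word M ω.1}, (isClopen_setOf_word_eq M _).isOpen, rfl,
      fun ω' h => hf _ _ h⟩)

variable (Ω)

/-- The centred word `ω_{-N} … ω_N`. -/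
def centredWord (N : ℕ) (ω : Ω.carrier) : Fin (2 * N + 1) → 𝓐 := fun i => ω.1 ((i : ℤ) - N)

theorem centredWord_iterate (N : ℕ) (ω : Ω.carrier) :
    centredWord Ω N ((shiftHomeo Ω)^[N + 1] ω) = word (2 * N + 1) ω.1 := by
  funext i
  rw [centredWord, shiftHomeo_iterate_apply, word]
  exact congrArg ω.1 (by push_cast; ring)

/-- A locally constant map of the subshift into itself that does not change `ω_{-N} … ω_N`: every
such word is replaced by a chosen point in which it occurs. -/
noncomputable def retract [Nonempty Ω.carrier] (N : ℕ) (ω : Ω.carrier) : Ω.carrier :=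
  Function.invFun (centredWord Ω N) (centredWord Ω N ω)

variable [Nonempty Ω.carrier]

theorem centredWord_retract (N : ℕ) (ω : Ω.carrier) :
    centredWord Ω N (retract Ω N ω) = centredWord Ω N ω :=
  Function.invFun_eq ⟨ω, rfl⟩

theorem retract_apply {N : ℕ} (ω : Ω.carrier) {i : ℤ} (hi : i.natAbs ≤ N) :
    (retract Ω N ω).1 i = ω.1 i := by
  have := congrFun (centredWord_retract Ω N ω) ⟨(i + N).toNat, by omega⟩
  simp only [centredWord] at this
  rwa [Int.toNat_of_nonneg (by omega), add_sub_cancel_right] at this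

theorem dependsOnWord_retract_iterate {Y : Type*} (f : Ω.carrier → Y) (N : ℕ) :
    DependsOnWord Ω (2 * N + 1) ((f ∘ retract Ω N) ∘ (shiftHomeo Ω)^[N + 1]) := by
  intro ω ω' h
  simp only [Function.comp_apply, retract, centredWord_iterate, h]

variable [DiscreteTopology 𝓐]

theorem continuous_retract (N : ℕ) : Continuous (retract Ω N) := by
  have h : Continuous (centredWord Ω N) :=
    continuous_pi fun i => (continuous_apply _).comp continuous_subtype_val
  exact (continuous_of_discreteTopology (f := Function.invFun (centredWord Ω N))).comp h

/-- `retract` as a continuous map. -/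
noncomputable def retractMap (N : ℕ) : C(Ω.carrier, Ω.carrier) :=
  ⟨retract Ω N, continuous_retract Ω N⟩

theorem tendsto_retractMap : Tendsto (retractMap Ω) atTop (𝓝 (ContinuousMap.id _)) := by
  rw [ContinuousMap.tendsto_nhds_compactOpen]
  intro K hK U hU hKU
  -- the points of `K` whose neighbourhood of size `N` lies in `U` form an open cover
  set V : ℕ → Set Ω.carrier := fun N =>
    {ω | ∀ ω' : Ω.carrier, (∀ i : ℤ, i.natAbs ≤ N → ω'.1 i = ω.1 i) → ω' ∈ U} with hV
  have hVmono : Monotone V := fun N N' h ω hω ω' h' => hω ω' fun i hi => h' i (hi.trans h)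
  have hVo : ∀ N, IsOpen (V N) := by
    intro N
    have hc : Continuous (centredWord Ω N) :=
      continuous_pi fun i => (continuous_apply _).comp continuous_subtype_val
    rw [isOpen_iff_mem_nhds]
    intro ω hω
    refine mem_of_superset (((isOpen_discrete {centredWord Ω N ω}).preimage hc).mem_nhds rfl) ?_
    intro ω₁ h1 ω' h'
    refine hω ω' fun i hi => (h' i hi).trans ?_
    have := congrFun h1 ⟨(i + N).toNat, by omega⟩
    simp only [centredWord] at this
    rwa [Int.toNat_of_nonneg (by omega), add_sub_cancel_right] at this
  have hcover : K ⊆ ⋃ N, V N := by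
    intro ω hω
    obtain ⟨W, hW, hWU⟩ := isOpen_induced_iff.1 hU
    have hωW : ω.1 ∈ W := by
      have : ω ∈ Subtype.val ⁻¹' W := hWU ▸ hKU hω
      exact this
    obtain ⟨I, u, hu, huW⟩ := isOpen_pi_iff.1 hW ω.1 hωW
    refine Set.mem_iUnion.2 ⟨∑ i ∈ I, i.natAbs, fun ω' h' => ?_⟩
    rw [← hWU]
    refine huW fun i hi => ?_
    rw [h' i (Finset.single_le_sum (f := Int.natAbs) (fun _ _ => Nat.zero_le _) hi)]
    exact (hu i hi).2
  obtain ⟨N, hN⟩ := hK.elim_directed_cover V hVo hcover hVmono.directed_le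
  refine eventually_atTop.2 ⟨N, fun n hn ω hω => ?_⟩
  exact hVmono hn (hN hω) _ fun i hi => retract_apply Ω ω hi

theorem tendsto_comp_retractMap {Y : Type*} [TopologicalSpace Y] (f : C(Ω.carrier, Y)) :
    Tendsto (fun N => f.comp (retractMap Ω N)) atTop (𝓝 f) :=
  ((ContinuousMap.continuous_postcomp f).tendsto _).comp (tendsto_retractMap Ω)

end Words

/-! ### Unique ergodicity under the Boshernitzan condition -/

section UniqueErgodicity

variable {𝓐 : Type*} [TopologicalSpace 𝓐] [DiscreteTopology 𝓐] {Ω : Subshift 𝓐 ℤ}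
  [MeasurableSpace Ω.carrier] {μ : Measure Ω.carrier} {C : ℝ}

/-- Every word of length `l` has measure at least `C / l`. -/
def HasLargeWords (μ : Measure Ω.carrier) (C : ℝ) (l : ℕ) : Prop :=
  ∀ ω : Ω.carrier, C ≤ l * μ.real (wordCylinder Ω (word l ω.1))

variable [BorelSpace Ω.carrier] [IsProbabilityMeasure μ]

theorem measurableSet_wordCylinder {n : ℕ} (w : Fin n → 𝓐) :
    MeasurableSet (wordCylinder Ω w) :=
  (isClopen_setOf_word_eq n w).isOpen.measurableSet

/-- While the Birkhoff sums of length `n` rise from below to above a level `b` along an orbit, the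
words seen within `K` steps before the first passage are pairwise distinct, hence
together have large measure. -/
theorem le_measure_of_first_passage {f : Ω.carrier → ℝ} {M : ℕ} {R : ℝ}
    (hf : DependsOnWord Ω M f) (hR : ∀ ω, |f ω| ≤ R) {l n K : ℕ} (hl : n + K + M ≤ l)
    (hl0 : 0 < l) (hlarge : HasLargeWords μ C l) {b : ℝ} {ω : Ω.carrier}
    (hbelow : ∀ i ≤ K, birkhoffSum (shiftHomeo Ω) f n ((shiftHomeo Ω)^[i] ω) < b)
    (habove : ∃ i, b ≤ birkhoffSum (shiftHomeo Ω) f n ((shiftHomeo Ω)^[i] ω)) :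
    K * (C / l) ≤ μ.real {x | ∃ s < K,
      b ≤ birkhoffSum (shiftHomeo Ω) f n ((shiftHomeo Ω)^[s] x) ∧
      birkhoffSum (shiftHomeo Ω) f n ((shiftHomeo Ω)^[s] x) ≤ b + 2 * R} := by
  classical
  set T := shiftHomeo Ω with hT
  set τ := Nat.find habove with hτ
  have hτ1 : b ≤ birkhoffSum T f n (T^[τ] ω) := Nat.find_spec habove
  have hτ2 : ∀ i < τ, birkhoffSum T f n (T^[i] ω) < b := fun i hi =>
    not_le.1 (Nat.find_min habove hi)
  have hτK : K < τ := by
    by_contra! h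
    exact (hbelow τ h).not_ge hτ1
  have hτ3 : birkhoffSum T f n (T^[τ] ω) ≤ b + 2 * R := by
    have h1 := hτ2 (τ - 1) (by omega)
    have h2 := (abs_le.1 (abs_birkhoffSum_iterate_sub_le (T := T) hR n 1 (T^[τ - 1] ω))).2
    rw [← Function.iterate_add_apply, show 1 + (τ - 1) = τ by omega] at h2
    push_cast at h2
    linarith
  have hcyl : ∀ s < K, ∀ x ∈ wordCylinder Ω (word l (T^[τ - s] ω).1),
      birkhoffSum T f n (T^[s] x) = birkhoffSum T f n (T^[τ] ω) := by
    intro s hs x hx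
    have := hf.birkhoffSum_eq (l := l) (n := n) (k := s) (by omega) hx
    rw [← hT, ← Function.iterate_add_apply, show s + (τ - s) = τ by omega] at this
    exact this
  have hsub : (⋃ s ∈ Finset.range K, wordCylinder Ω (word l (T^[τ - s] ω).1)) ⊆
      {x | ∃ s < K, b ≤ birkhoffSum T f n (T^[s] x) ∧
        birkhoffSum T f n (T^[s] x) ≤ b + 2 * R} := by
    intro x hx
    obtain ⟨s, hs, hxs⟩ := Set.mem_iUnion₂.1 hx
    rw [Finset.mem_range] at hs
    exact ⟨s, hs, by rw [hcyl s hs x hxs]; exact hτ1, by rw [hcyl s hs x hxs]; exact hτ3⟩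
  have hdisj : ∀ s < K, ∀ s' < s, Disjoint (wordCylinder Ω (word l (T^[τ - s] ω).1))
      (wordCylinder Ω (word l (T^[τ - s'] ω).1)) := by
    intro s hs s' hs'
    rw [Set.disjoint_left]
    intro x hx hx'
    -- the word at time `τ - s` would reach the level `b` already at time `τ - s + s' < τ`
    have h1 := hcyl s' (by omega) x hx'
    have h2 := hf.birkhoffSum_eq (l := l) (n := n) (k := s') (by omega) hx
    rw [← hT, h1, ← Function.iterate_add_apply] at h2
    have h3 := hτ2 (s' + (τ - s)) (by omega)
    linarith
  refine le_trans ?_ (measureReal_mono hsub)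
  rw [measureReal_biUnion_finset]
  · have hl0' : (0 : ℝ) < l := by exact_mod_cast hl0
    calc (K : ℝ) * (C / l) = ∑ s ∈ Finset.range K, C / l := by simp
      _ ≤ _ := Finset.sum_le_sum fun s _ => by
        rw [div_le_iff₀' hl0']
        exact hlarge _
  · intro s hs s' hs' hne
    simp only [Finset.coe_range, Set.mem_Iio] at hs hs'
    rcases lt_or_gt_of_ne hne with h | h
    · exact (hdisj s' hs' s h).symm
    · exact hdisj s hs s' h
  · exact fun s _ => measurableSet_wordCylinder _

/-- If the Birkhoff sums of length `n` pass along one orbit through `K` levels with spacing `Δ`,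
the words seen while approaching each of these levels carry definite mass. When, outside a small
set, the Birkhoff sums change little over the length of these words, the level can be
recovered from any point of the word, so these masses add up to at most one. -/
theorem card_levels_mul_le_one {f : Ω.carrier → ℝ} {M : ℕ} {R : ℝ}
    (hf : DependsOnWord Ω M f) (hR : ∀ ω, |f ω| ≤ R) {l n J d K : ℕ} (hl : n + J * d + M ≤ l)
    (hl0 : 0 < l) (hd0 : 0 < d) (hlarge : HasLargeWords μ C l) {b Δ δ η : ℝ} (hΔ : 0 ≤ Δ)
    {x : Ω.carrier}
    (hE : ∀ j : ℕ, μ.real {z | δ < |birkhoffSum (shiftHomeo Ω) f n ((shiftHomeo Ω)^[j] z) -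
      birkhoffSum (shiftHomeo Ω) f n z|} ≤ η)
    (hsep : 2 * (δ + 2 * R * d + 2 * R) < Δ)
    (hbelow : ∀ i ≤ J * d, birkhoffSum (shiftHomeo Ω) f n ((shiftHomeo Ω)^[i] x) < b)
    (habove : ∃ i, b + K * Δ ≤ birkhoffSum (shiftHomeo Ω) f n ((shiftHomeo Ω)^[i] x)) :
    K * ((J * d : ℕ) * (C / l) - J * η) ≤ 1 := by
  have hR0 : 0 ≤ R := (abs_nonneg _).trans (hR x)
  have hfc := hf.continuous
  set T := shiftHomeo Ω with hT
  set S := birkhoffSum T f n with hS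
  have hSc : Continuous S := continuous_finsetSum _ fun i _ => hfc.comp (continuous_iterate T i)
  set G : ℕ → Set Ω.carrier := fun i => {z | ∃ s < J * d, b + i * Δ ≤ S (T^[s] z) ∧
    S (T^[s] z) ≤ b + i * Δ + 2 * R} with hG
  have hGmeas : ∀ i < K, (J * d : ℕ) * (C / l) ≤ μ.real (G i) := by
    intro i hi
    refine le_measure_of_first_passage (ω := x) hf hR hl hl0 hlarge (fun j hj => ?_) ?_
    · exact (hbelow j hj).trans_le (le_add_of_nonneg_right (by positivity))
    · obtain ⟨k, hk⟩ := habove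
      refine ⟨k, le_trans ?_ hk⟩
      gcongr
  set E : Set Ω.carrier := ⋃ j ∈ Finset.range J, {z | δ < |S (T^[j * d] z) - S z|} with hE'
  have hEμ : μ.real E ≤ J * η := by
    refine (measureReal_biUnion_finset_le _ _).trans ?_
    exact (Finset.sum_le_card_nsmul _ _ η fun j _ => hE (j * d)).trans_eq (by simp)
  have hEm : MeasurableSet E := by
    refine Finset.measurableSet_biUnion _ fun j _ => ?_
    exact (isOpen_lt continuous_const
      ((hSc.comp (continuous_iterate T _)).sub hSc).abs).measurableSet
  have hGm : ∀ i, MeasurableSet (G i) := by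
    intro i
    have : G i = ⋃ s ∈ Finset.range (J * d),
        (S ∘ T^[s]) ⁻¹' Set.Icc (b + i * Δ) (b + i * Δ + 2 * R) := by
      ext z; simp only [hG, Set.mem_ofPred_eq, Set.mem_iUnion, Finset.mem_range, exists_prop,
        Set.mem_preimage, Function.comp_apply, Set.mem_Icc]
    rw [this]
    exact Finset.measurableSet_biUnion _ fun s _ =>
      (isClosed_Icc.preimage (hSc.comp (continuous_iterate T s))).measurableSet
  -- outside the exceptional set the level is already visible at the start of the word
  have hclose : ∀ i : ℕ, ∀ z ∈ G i \ E, |S z - (b + i * Δ)| ≤ δ + 2 * R * d + 2 * R := by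
    rintro i z ⟨⟨s, hs, h1, h2⟩, hzE⟩
    have hj : s / d < J := Nat.div_lt_of_lt_mul (by rwa [mul_comm] at hs)
    have h3 : |S (T^[s / d * d] z) - S z| ≤ δ := by
      by_contra! h
      exact hzE (Set.mem_iUnion₂.2 ⟨s / d, Finset.mem_range.2 hj, h⟩)
    have h4 := abs_birkhoffSum_iterate_sub_le (T := T) hR n (s % d) (T^[s / d * d] z)
    rw [← Function.iterate_add_apply, Nat.mod_add_div'] at h4
    have h5 : ((s % d : ℕ) : ℝ) ≤ d := by exact_mod_cast (Nat.mod_lt s hd0).le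
    have h6 : 2 * R * ((s % d : ℕ) : ℝ) ≤ 2 * R * d := by gcongr
    have a1 := abs_le.1 h3
    have a2 := abs_le.1 h4
    rw [abs_le]
    constructor <;> linarith
  have hdisj : ∀ i j : ℕ, i < j → Disjoint (G i \ E) (G j \ E) := by
    intro i j hij
    rw [Set.disjoint_left]
    intro z hi hj
    have h1 := abs_le.1 (hclose i z hi)
    have h2 := abs_le.1 (hclose j z hj)
    have h4 : (i : ℝ) + 1 ≤ j := by exact_mod_cast hij
    have h5 : ((i : ℝ) + 1) * Δ ≤ j * Δ := mul_le_mul_of_nonneg_right h4 hΔ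
    linarith
  have htotal : ∑ i ∈ Finset.range K, μ.real (G i \ E) ≤ 1 := by
    rw [← measureReal_biUnion_finset]
    · exact measureReal_le_one
    · intro i _ j _ hne
      rcases lt_or_gt_of_ne hne with h | h
      · exact hdisj i j h
      · exact (hdisj j i h).symm
    · exact fun i _ => (hGm i).diff hEm
  have heach : ∀ i ∈ Finset.range K, (J * d : ℕ) * (C / l) - J * η ≤ μ.real (G i \ E) := by
    intro i hi
    have h1 := hGmeas i (Finset.mem_range.1 hi)
    have h2 := le_measureReal_sdiff (μ := μ) (s₁ := G i) (s₂ := E) (measure_ne_top μ E)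
    linarith
  have hfin := (Finset.card_nsmul_le_sum _ _ _ heach).trans htotal
  rwa [Finset.card_range, nsmul_eq_mul] at hfin

/-- Under the Boshernitzan condition the Birkhoff averages of locally constant functions have
small oscillation. Otherwise they pass through arbitrarily many well separated levels; the
words seen while approaching each of them have measure bounded below, and by the mean ergodic
theorem most points in these words have averages close to that level. -/
theorem hasSmallOscillation_of_dependsOnWord [Finite 𝓐] (hmin : IsMinimal (shiftHomeo Ω))
    (hμ : MeasurePreserving (shiftHomeo Ω) μ μ) (hC : 0 < C)
    (hfreq : ∃ᶠ l in atTop, HasLargeWords μ C l) {f : Ω.carrier → ℝ} {M : ℕ}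
    (hf : DependsOnWord Ω M f) : HasSmallOscillation (shiftHomeo Ω) f := by
  have hfc := hf.continuous
  obtain ⟨R, hR1, hR⟩ : ∃ R : ℝ, 1 ≤ R ∧ ∀ x, |f x| ≤ R := by
    obtain ⟨R, hR⟩ := (isCompact_range (continuous_abs.comp hfc)).bddAbove
    exact ⟨max 1 R, le_max_left _ _, fun x => (hR (Set.mem_range_self x)).trans (le_max_right _ _)⟩
  intro ε hε
  by_contra! hcon
  -- the parameters `a`, `K`, `J`, `N` depend only on `ε`, `R` and `C`
  obtain ⟨a, ha⟩ := exists_nat_gt (4 * R / ε)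
  rw [div_lt_iff₀ hε] at ha
  have ha0 : 0 < a := by
    rcases Nat.eq_zero_or_pos a with rfl | h
    · norm_num at ha; linarith
    · exact h
  have ha0' : (0 : ℝ) < a := by exact_mod_cast ha0
  obtain ⟨K, hK⟩ := exists_nat_gt (6 * a / C)
  rw [div_lt_iff₀ hC] at hK
  have hK0' : (0 : ℝ) < K := by
    have : 0 < (K : ℝ) * C := lt_trans (by positivity) hK
    exact pos_of_mul_pos_left this hC.le
  have hK0 : 0 < K := by exact_mod_cast hK0'
  obtain ⟨J, hJ⟩ : ∃ J, J = 8 * K := ⟨_, rfl⟩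
  obtain ⟨N, hN⟩ : ∃ N, N = a * J := ⟨_, rfl⟩
  have hJ0 : 0 < J := by omega
  have hN0 : 0 < N := hN ▸ Nat.mul_pos ha0 hJ0
  have hJN : J ≤ N := hN ▸ Nat.le_mul_of_pos_left J ha0
  have hN0' : (0 : ℝ) < N := by exact_mod_cast hN0
  obtain ⟨N₀, hN₀⟩ := exists_measure_birkhoffSum_iterate_le hμ hfc.measurable hR
    (δ := ε / (16 * K)) (η := C / (6 * N)) (by positivity) (by positivity)
  obtain ⟨l, hlge, hlarge⟩ := frequently_atTop.1 hfreq (M + 2 * N * (M + 2 + N₀))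
  -- block length `d`, averaging length `n = N d`, look-back time `J d`
  obtain ⟨d, hd⟩ : ∃ d, d = (l - M) / (2 * N) := ⟨_, rfl⟩
  have hdge : M + 2 + N₀ ≤ d := by
    rw [hd, Nat.le_div_iff_mul_le (by omega)]
    have : (M + 2 + N₀) * (2 * N) = 2 * N * (M + 2 + N₀) := by ring
    omega
  obtain ⟨n, hn⟩ : ∃ n, n = N * d := ⟨_, rfl⟩
  have hd1 : 2 * n + M ≤ l := by
    have h1 := Nat.div_mul_le_self (l - M) (2 * N)
    rw [← hd] at h1
    have h2 : d * (2 * N) = 2 * (N * d) := by ring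
    omega
  have hd2 : l ≤ 3 * n := by
    have h1 := Nat.lt_div_mul_add (a := l - M) (b := 2 * N) (by omega)
    rw [← hd] at h1
    have h2 : d * (2 * N) = 2 * (N * d) := by ring
    have h3 : N * (M + 2) ≤ N * d := Nat.mul_le_mul_left N (by omega)
    have h4 : N * (M + 2) = N * M + 2 * N := by ring
    have h5 : M ≤ N * M := Nat.le_mul_of_pos_left M hN0
    omega
  have hn1 : N₀ ≤ n := hn ▸ le_trans (by omega) (Nat.le_mul_of_pos_left d hN0)
  have hd0 : 0 < d := by omega
  have hn0 : 0 < n := hn ▸ Nat.mul_pos hN0 hd0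
  have hJd : J * d ≤ n := hn ▸ Nat.mul_le_mul_right d hJN
  have hd0' : (1 : ℝ) ≤ d := by exact_mod_cast hd0
  have hn0' : (0 : ℝ) < n := by exact_mod_cast hn0
  have hl0 : 0 < l := by omega
  have hl0' : (0 : ℝ) < l := by exact_mod_cast hl0
  have hnr : (n : ℝ) = N * d := by rw [hn]; push_cast; rfl
  have hNr : (N : ℝ) = a * (8 * K) := by rw [hN, hJ]; push_cast; rfl
  have hJr : (J : ℝ) = 8 * K := by rw [hJ]; push_cast; rfl
  have hlr : (l : ℝ) ≤ 3 * (N * d) := by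
    rw [← hnr]; exact_mod_cast hd2
  -- a point with low average and a point with high average
  obtain ⟨x, y, hxy⟩ : ∃ x y, birkhoffSum (shiftHomeo Ω) f n x + ε * n <
      birkhoffSum (shiftHomeo Ω) f n y := by
    obtain ⟨x, y, hxy⟩ := hcon n hn0
    rcases lt_abs.1 hxy with h | h
    · exact ⟨y, x, by linarith⟩
    · exact ⟨x, y, by linarith⟩
  have hSc : Continuous (birkhoffSum (shiftHomeo Ω) f n) :=
    continuous_finsetSum _ fun i _ => hfc.comp (continuous_iterate _ i)
  obtain ⟨Δ, hΔ⟩ : ∃ Δ, Δ = ε * n / (2 * K) := ⟨_, rfl⟩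
  have hKΔ : K * Δ = ε * n / 2 := by rw [hΔ]; field_simp
  have hsep : 2 * (ε / (16 * K) * n + 2 * R * d + 2 * R) < Δ := by
    have h2 : 4 * R * d ≤ ε * n / (8 * K) := by
      rw [le_div_iff₀ (by positivity), hnr, hNr]
      have : 4 * R * (8 * K * d) ≤ a * ε * (8 * K * d) :=
        mul_le_mul_of_nonneg_right ha.le (by positivity)
      linarith
    have h3 : 4 * R * 1 ≤ 4 * R * d := mul_le_mul_of_nonneg_left hd0' (by linarith)
    have h4 : ε / (16 * K) * n = Δ / 8 := by rw [hΔ]; field_simp; norm_num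
    have h5 : ε * n / (8 * K) = Δ / 4 := by rw [hΔ]; field_simp; norm_num
    have h6 : 0 < Δ := by rw [hΔ]; positivity
    linarith
  have hfin := card_levels_mul_le_one (x := x) (K := K) (J := J)
    (b := birkhoffSum (shiftHomeo Ω) f n x + ε * n / 2)
    hf hR (by omega) hl0 hd0 hlarge (by rw [hΔ]; positivity) (hN₀ n hn1) hsep (fun j hj => ?_) ?_
  · have h1 : (J * d : ℕ) * (C / l) ≥ J * (2 * (C / (6 * N))) := by
      have : 2 * (C / (6 * N)) ≤ d * (C / l) := by
        rw [← mul_div_assoc, ← mul_div_assoc, div_le_div_iff₀ (by positivity) hl0']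
        have := mul_le_mul_of_nonneg_left hlr hC.le
        linarith
      push_cast
      rw [mul_assoc]
      exact mul_le_mul_of_nonneg_left this (by positivity)
    have h2 : K * (J * (C / (6 * N))) ≤ 1 :=
      le_trans (mul_le_mul_of_nonneg_left (by linarith) hK0'.le) hfin
    have h3 : K * (J * (C / (6 * N))) = K * C / (6 * a) := by
      rw [hJr, hNr]; field_simp
    rw [h3, div_le_one (by positivity)] at h2
    linarith
  · have h1 := (abs_le.1 (abs_birkhoffSum_iterate_sub_le (T := shiftHomeo Ω) hR n j x)).2
    have h2 : (j : ℝ) ≤ 8 * K * d := by rw [← hJr]; exact_mod_cast hj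
    have h3 : 2 * R * j ≤ 2 * R * (8 * K * d) := mul_le_mul_of_nonneg_left h2 (by linarith)
    have h4 : 4 * R * (8 * K * d) < a * ε * (8 * K * d) :=
      mul_lt_mul_of_pos_right ha (by positivity)
    have h5 : ε * n = a * ε * (8 * K * d) := by rw [hnr, hNr]; ring
    linarith
  · obtain ⟨k, hk⟩ := hmin.exists_iterate_mem
      (U := {z | birkhoffSum (shiftHomeo Ω) f n x + ε * n < birkhoffSum (shiftHomeo Ω) f n z})
      (isOpen_lt continuous_const hSc) ⟨y, hxy⟩ x
    have hk' : birkhoffSum (shiftHomeo Ω) f n x + ε * n <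
      birkhoffSum (shiftHomeo Ω) f n ((shiftHomeo Ω)^[k] x) := hk
    exact ⟨k, by linarith⟩

theorem hasUniformAverages_of_hasLargeWords [Finite 𝓐] (hmin : IsMinimal (shiftHomeo Ω))
    (hμ : MeasurePreserving (shiftHomeo Ω) μ μ) (hC : 0 < C)
    (hfreq : ∃ᶠ l in atTop, HasLargeWords μ C l) (f : C(Ω.carrier, ℝ)) :
    HasUniformAverages (shiftHomeo Ω) f := by
  have : Nonempty Ω.carrier := nonempty_of_isProbabilityMeasure μ
  have hosc : HasSmallOscillation (shiftHomeo Ω) f := by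
    refine HasSmallOscillation.of_approx fun ε hε => ?_
    obtain ⟨N, hN⟩ := Metric.tendsto_atTop.1 (tendsto_comp_retractMap Ω f) ε hε
    refine ⟨f ∘ retract Ω N, HasSmallOscillation.of_comp_iterate (k := N + 1)
      (hasSmallOscillation_of_dependsOnWord hmin hμ hC hfreq
        (dependsOnWord_retract_iterate Ω f N)) (shiftHomeo Ω).surjective, fun x => ?_⟩
    have h := (ContinuousMap.dist_lt_iff hε).1 (hN N le_rfl) x
    rw [dist_comm] at h
    exact h.le
  obtain ⟨R, hR⟩ := (isCompact_range (continuous_abs.comp f.continuous)).bddAbove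
  exact hosc.hasUniformAverages fun x => hR (Set.mem_range_self x)

end UniqueErgodicity

/-! ### The maximal Lyapunov exponent -/

section Lyapunov

variable {X : Type*} [TopologicalSpace X] (T : X ≃ₜ X) (A : C(X, SL(2, ℝ)))

/-- The maximal Lyapunov exponent `L`, the limit and infimum of `sup_ω (1/n) log ‖A_n(ω)‖`, in the
form of the two bounds it provides. -/
theorem exists_maximal_exponent [CompactSpace X] [Nonempty X] : ∃ L : ℝ, 0 ≤ L ∧
    (∀ (n : ℕ) (B : ℝ), (∀ ω, logNorm T A n ω ≤ B) → n * L ≤ B) ∧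
    ∀ ε > 0, ∃ K : ℝ, 0 ≤ K ∧ ∀ n ω, logNorm T A n ω ≤ n * (L + ε) + K := by
  obtain ⟨R, hR0, hR⟩ := exists_logNorm_le T A
  set u : ℕ → ℝ := fun n => ⨆ ω, logNorm T A n ω with hu
  have hbdd : ∀ n, BddAbove (Set.range (logNorm T A n)) := fun n =>
    ⟨n * R, by rintro _ ⟨ω, rfl⟩; exact hR n ω⟩
  have hle : ∀ n ω, logNorm T A n ω ≤ u n := fun n ω => le_ciSup (hbdd n) ω
  obtain ⟨ω₀⟩ := ‹Nonempty X›
  have hu0 : ∀ n, 0 ≤ u n := fun n => (logNorm_nonneg T A n ω₀).trans (hle n ω₀)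
  have hsub : Subadditive u := fun m n => ciSup_le fun ω =>
    (logNorm_add_le T A m n ω).trans (add_le_add (hle _ _) (hle _ _))
  have hbelow : BddBelow (Set.range fun n => u n / n) :=
    ⟨0, by rintro _ ⟨n, rfl⟩; exact div_nonneg (hu0 n) (Nat.cast_nonneg n)⟩
  refine ⟨hsub.lim, ge_of_tendsto (hsub.tendsto_lim hbelow)
    (Eventually.of_forall fun n => div_nonneg (hu0 n) (Nat.cast_nonneg n)), ?_, ?_⟩
  · intro n B hB
    rcases Nat.eq_zero_or_pos n with rfl | hn
    · simpa using (logNorm_nonneg T A 0 ω₀).trans (hB ω₀)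
    · have h := hsub.lim_le_div hbelow hn.ne'
      rw [le_div_iff₀' (by exact_mod_cast hn)] at h
      exact h.trans (ciSup_le hB)
  · intro ε hε
    obtain ⟨N, hN⟩ := eventually_atTop.1
      ((hsub.tendsto_lim hbelow).eventually_lt_const (lt_add_of_pos_right _ hε))
    have hL : 0 ≤ hsub.lim := ge_of_tendsto (hsub.tendsto_lim hbelow)
      (Eventually.of_forall fun n => div_nonneg (hu0 n) (Nat.cast_nonneg n))
    refine ⟨N * R, by positivity, fun n ω => ?_⟩
    rcases le_or_gt (N + 1) n with h | h
    · have h1 := hN n (by omega)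
      rw [div_lt_iff₀' (by exact_mod_cast (by omega : 0 < n))] at h1
      have : 0 ≤ N * R := by positivity
      linarith [hle n ω]
    · have h1 : (n : ℝ) * R ≤ N * R :=
        mul_le_mul_of_nonneg_right (by exact_mod_cast (by omega : n ≤ N)) hR0
      have h2 : 0 ≤ n * (hsub.lim + ε) := by positivity
      linarith [hR n ω]

/-- An orbit starting in `V` is counted as visiting `V` exactly once until a return is possible. -/
theorem birkhoffSum_indicator_eq_one {V : Set X} {g : ℕ}
    (hV : ∀ z ∈ V, ∀ q, 0 < q → q < g → T^[q] z ∉ V) {k : ℕ} (hk0 : 0 < k) (hk : k ≤ g) {z : X}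
    (hz : z ∈ V) : birkhoffSum T (V.indicator fun _ => (1 : ℝ)) k z = 1 := by
  rw [birkhoffSum, Finset.sum_eq_single_of_mem 0 (Finset.mem_range.2 hk0)]
  · exact Set.indicator_of_mem hz _
  · intro b hb hb0
    exact Set.indicator_of_notMem (hV z hz b (Nat.pos_of_ne_zero hb0)
      ((Finset.mem_range.1 hb).trans_le hk)) _

/-- If the growth over `n` steps is small at the points of `V`, every visit to `V` saves a definite
amount in the upper bound for the growth, provided successive visits are at least `n` steps apart. -/
theorem logNorm_le_sub_visits {V : Set X} {n : ℕ} {L K v D : ℝ} (hn : 0 < n)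
    (hV : ∀ z ∈ V, ∀ q, 0 < q → q < n → T^[q] z ∉ V) (hv : ∀ z ∈ V, logNorm T A n z ≤ v)
    (hK : ∀ k z, logNorm T A k z ≤ k * L + K) (hD : D = n * L - v - K) (hD0 : 0 ≤ D)
    (t : ℕ) (x : X) :
    logNorm T A t x ≤ t * L + K + D - D * birkhoffSum T (V.indicator fun _ => (1 : ℝ)) t x := by
  classical
  induction t using Nat.strong_induction_on generalizing x with
  | _ t ih =>
    set f : X → ℝ := V.indicator fun _ => (1 : ℝ) with hf
    by_cases hex : ∃ i, i < t ∧ T^[i] x ∈ V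
    · obtain ⟨i, hit, hiV, himin⟩ : ∃ i, i < t ∧ T^[i] x ∈ V ∧ ∀ j < i, T^[j] x ∉ V :=
        ⟨Nat.find hex, (Nat.find_spec hex).1, (Nat.find_spec hex).2, fun j hj hjV =>
          Nat.find_min hex hj ⟨hj.trans (Nat.find_spec hex).1, hjV⟩⟩
      have hzero : birkhoffSum T f i x = 0 := Finset.sum_eq_zero fun j hj =>
        Set.indicator_of_notMem (himin j (Finset.mem_range.1 hj)) _
      rcases le_or_gt (i + n) t with h | h
      · obtain ⟨r, rfl⟩ : ∃ r, t = i + (n + r) := ⟨t - i - n, by omega⟩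
        have h1 := logNorm_add_le T A (r + n) i x
        have h2 := logNorm_add_le T A r n (T^[i] x)
        have h3 := ih r (by omega) (T^[n] (T^[i] x))
        have h4 := hv _ hiV
        have h5 := hK i x
        rw [birkhoffSum_add, hzero, birkhoffSum_add,
          birkhoffSum_indicator_eq_one T hV hn le_rfl hiV]
        rw [show r + n + i = i + (n + r) by omega] at h1
        push_cast
        linarith
      · obtain ⟨r, rfl⟩ : ∃ r, t = i + r := ⟨t - i, by omega⟩
        rw [birkhoffSum_add, hzero,
          birkhoffSum_indicator_eq_one T hV (by omega) (by omega) hiV]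
        linarith [hK (i + r) x]
    · have hzero : birkhoffSum T f t x = 0 :=
        Finset.sum_eq_zero fun j hj => Set.indicator_of_notMem (fun hjV =>
          hex ⟨j, Finset.mem_range.1 hj, hjV⟩) _
      rw [hzero]
      linarith [hK t x]

end Lyapunov

/-! ### Words without short returns -/

section Returns

variable {𝓐 : Type*} [TopologicalSpace 𝓐] {Ω : Subshift 𝓐 ℤ}

/-- In an aperiodic minimal subshift, every one-sided periodic stretch comes to an end. -/
theorem exists_ne_add_period [Finite 𝓐] [DiscreteTopology 𝓐] (haper : IsAperiodic (shiftHomeo Ω))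
    (hmin : IsMinimal (shiftHomeo Ω)) (ω : Ω.carrier) {p : ℕ} (hp : 0 < p) :
    ∃ e : ℕ, 1 ≤ e ∧ ω.1 ((e : ℤ) + p) ≠ ω.1 e := by
  set U : Set Ω.carrier := {z | z.1 (1 + (p : ℤ)) ≠ z.1 1} with hU
  have hUo : IsOpen U := by
    have h : Continuous fun z : Ω.carrier => (z.1 (1 + (p : ℤ)), z.1 1) :=
      ((continuous_apply _).comp continuous_subtype_val).prodMk
        ((continuous_apply _).comp continuous_subtype_val)
    exact (isOpen_discrete {q : 𝓐 × 𝓐 | q.1 ≠ q.2}).preimage h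
  have hUne : U.Nonempty := by
    by_contra hne
    rw [Set.not_nonempty_iff_eq_empty] at hne
    have hall : ∀ z : Ω.carrier, z.1 (1 + (p : ℤ)) = z.1 1 := fun z => by
      by_contra h
      have : z ∈ U := h
      rw [hne] at this
      exact this
    refine haper ω p hp (Subtype.ext (funext fun k => ?_))
    rw [shiftHomeo_iterate_apply]
    obtain ⟨z, rfl⟩ := (shiftHomeo Ω).surjective.iterate (k.natAbs + 1) ω
    have h := hall ((shiftHomeo Ω)^[(k + k.natAbs).toNat] z)
    rw [shiftHomeo_iterate_apply, shiftHomeo_iterate_apply, Int.toNat_of_nonneg (by omega)] at h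
    rw [shiftHomeo_iterate_apply, shiftHomeo_iterate_apply]
    exact (congrArg z.1 (by push_cast; ring)).trans (h.trans (congrArg z.1 (by push_cast; ring)))
  obtain ⟨k, hk⟩ := hmin.exists_iterate_mem hUo hUne ω
  have hk' : ((shiftHomeo Ω)^[k] ω).1 (1 + (p : ℤ)) ≠ ((shiftHomeo Ω)^[k] ω).1 1 := hk
  rw [shiftHomeo_iterate_apply, shiftHomeo_iterate_apply] at hk'
  refine ⟨k + 1, by omega, ?_⟩
  rw [show ((k + 1 : ℕ) : ℤ) + p = 1 + p + k by push_cast; ring,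
    show ((k + 1 : ℕ) : ℤ) = 1 + k by push_cast; ring]
  exact hk'

/-- Every word of length `m` occurs in a word of length `l` which has no return in less than `g`
steps. If the obvious extension of the given word has a short return, it is periodic with a small
period; then a word at the end of the periodic stretch contains the given word as well, and
has no short return because its last letter breaks the period. -/
theorem exists_word_without_short_returns [Finite 𝓐] [DiscreteTopology 𝓐]
    (haper : IsAperiodic (shiftHomeo Ω)) (hmin : IsMinimal (shiftHomeo Ω)) (ω : Ω.carrier)
    {m l g : ℕ} (hl : m + 2 * g ≤ l) :
    ∃ (ω₁ : Ω.carrier) (j : ℕ),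
      (∀ z : Ω.carrier, word l z.1 = word l ω₁.1 →
        word m ((shiftHomeo Ω)^[j] z).1 = word m ω.1) ∧
      ∀ z : Ω.carrier, word l z.1 = word l ω₁.1 → ∀ q, 0 < q → q < g →
        word l ((shiftHomeo Ω)^[q] z).1 ≠ word l ω₁.1 := by
  classical
  by_cases hret : ∀ z : Ω.carrier, word l z.1 = word l ω.1 → ∀ q, 0 < q → q < g →
      word l ((shiftHomeo Ω)^[q] z).1 ≠ word l ω.1
  · exact ⟨ω, 0, fun z hz => word_iterate_eq Ω (k := 0) (by omega) hz, hret⟩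
  push Not at hret
  obtain ⟨z, hz, p, hp0, hpg, hzp⟩ := hret
  have hper : ∀ i : ℤ, 1 ≤ i → i + p ≤ l → ω.1 (i + p) = ω.1 i := by
    intro i h1 h2
    rw [word_eq_iff] at hz hzp
    rw [← hz _ (by omega) h2, ← hzp i h1 (by omega), shiftHomeo_iterate_apply]
  have hex := exists_ne_add_period haper hmin ω hp0
  set e := Nat.find hex with he
  obtain ⟨he1, hene⟩ : 1 ≤ e ∧ ω.1 ((e : ℤ) + p) ≠ ω.1 e := Nat.find_spec hex
  have hrun : ∀ i : ℤ, 1 ≤ i → i < e → ω.1 (i + p) = ω.1 i := by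
    intro i h1 h2
    have := Nat.find_min hex (m := i.toNat) (by omega)
    by_contra hne
    refine this ⟨by omega, ?_⟩
    rwa [Int.toNat_of_nonneg (by omega)]
  have hel : l < e + p := by
    by_contra! h
    exact hene (hper e (by omega) (by omega))
  have hmult : ∀ (k : ℕ) (i : ℤ), 1 ≤ i → i + k * p < e + p → ω.1 (i + k * p) = ω.1 i := by
    intro k
    induction k with
    | zero => intro i _ _; simp
    | succ k ih =>
      intro i h1 h2
      push_cast at h2 ⊢
      rw [add_mul, one_mul, ← add_assoc] at h2 ⊢
      have h0 : (0 : ℤ) ≤ k * p := by positivity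
      rw [hrun _ (by omega) (by omega), ih i h1 (by omega)]
  -- the word ends at `e + p`, one letter beyond the periodic stretch
  obtain ⟨s, hs⟩ : ∃ s, s + l = e + p := ⟨e + p - l, by omega⟩
  obtain ⟨k, j, hkj, hjp⟩ : ∃ k j : ℕ, s + j = k * p ∧ j < p := by
    refine ⟨(s + p - 1) / p, (s + p - 1) / p * p - s, ?_, ?_⟩
    · have := Nat.lt_div_mul_add (a := s + p - 1) (b := p) hp0
      omega
    · have := Nat.div_mul_le_self (s + p - 1) p
      omega
  have hkj' : (s : ℤ) + j = k * p := by exact_mod_cast hkj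
  have hs' : (s : ℤ) + l = e + p := by exact_mod_cast hs
  have hω₁ : ∀ z : Ω.carrier, word l z.1 = word l ((shiftHomeo Ω)^[s] ω).1 →
      ∀ i : ℤ, 1 ≤ i → i ≤ l → z.1 i = ω.1 (i + s) := by
    intro z hz i h1 h2
    rw [word_eq_iff] at hz
    rw [hz i h1 h2, shiftHomeo_iterate_apply]
  refine ⟨(shiftHomeo Ω)^[s] ω, j, fun z hz => ?_, fun z hz q hq0 hqg hzq => ?_⟩
  · rw [word_eq_iff]
    intro i h1 h2
    rw [shiftHomeo_iterate_apply, hω₁ z hz _ (by omega) (by omega),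
      show i + (j : ℤ) + s = i + k * p by linarith]
    exact hmult k i h1 (by omega)
  · have h1 := hω₁ z hz
    have h2 := hω₁ _ hzq
    have hq : ∀ i : ℤ, 1 ≤ i → i + q ≤ l → ω.1 (i + q + s) = ω.1 (i + s) := by
      intro i hi1 hi2
      rw [← h1 _ (by omega) hi2, ← h2 i hi1 (by omega), shiftHomeo_iterate_apply]
    -- compare the last letter with the one `p` steps earlier through the period `q`
    have e1 := hq ((l : ℤ) - q) (by omega) (by omega)
    have e2 := hq ((l : ℤ) - q - p) (by omega) (by omega)
    have e3 := hrun ((l : ℤ) - q - p + s) (by omega) (by omega)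
    apply hene
    rw [show (e : ℤ) + p = (l : ℤ) - q + q + s by linarith, e1,
      show (l : ℤ) - q + s = (l : ℤ) - q - p + s + p by ring, e3, ← e2]
    exact congrArg ω.1 (by linarith)

end Returns

/-! ### Locally constant cocycles -/

theorem integral_birkhoffSum {X : Type*} [MeasurableSpace X] {μ : Measure X} {T : X → X}
    (hT : MeasurePreserving T μ μ) {f : X → ℝ} (hf : Integrable f μ) (n : ℕ) :
    ∫ x, birkhoffSum T f n x ∂μ = n * ∫ x, f x ∂μ := by
  have hi : ∀ i : ℕ, ∫ x, f (T^[i] x) ∂μ = ∫ x, f x ∂μ := by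
    intro i
    have h := hT.iterate i
    have hf' : AEStronglyMeasurable f (μ.map T^[i]) := by
      rw [h.map_eq]; exact hf.aestronglyMeasurable
    rw [← integral_map h.measurable.aemeasurable hf', h.map_eq]
  have hint : ∀ i ∈ Finset.range n, Integrable (fun x => f (T^[i] x)) μ := fun i _ =>
    (hT.iterate i).integrable_comp_of_integrable hf
  simp only [birkhoffSum]
  rw [integral_finsetSum _ hint]
  simp [hi]

theorem isUniform_of_comp_iterate {X : Type*} [TopologicalSpace X] {T : X ≃ₜ X}
    {A B : C(X, SL(2, ℝ))} {k : ℕ} (hAB : ∀ ω, B ω = A (T^[k] ω)) (hB : IsUniform T B) :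
    IsUniform T A := by
  have e : ∀ n ω, iter T B n ω = iter T A n (T^[k] ω) := by
    intro n ω
    induction n with
    | zero => rfl
    | succ n ih =>
      rw [iter, iter, ih, hAB, ← Function.iterate_add_apply, ← Function.iterate_add_apply,
        add_comm]
  obtain ⟨L, hL⟩ := hB
  refine ⟨L, tendstoUniformly_const_iff.2 fun ε hε => ?_⟩
  obtain ⟨N, hN⟩ := tendstoUniformly_const_iff.1 hL ε hε
  refine ⟨N, fun n hn ω => ?_⟩
  obtain ⟨x, rfl⟩ := T.surjective.iterate k ω
  rw [← e]
  exact hN n hn x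

/-- The Boshernitzan condition in terms of real numbers. -/
theorem exists_frequently_hasLargeWords {𝓐 : Type*} [TopologicalSpace 𝓐]
    {Ω : Subshift 𝓐 ℤ} [MeasurableSpace Ω.carrier] {μ : Measure Ω.carrier} [IsProbabilityMeasure μ]
    (h : 0 < limsup (fun n : ℕ => (n : ℝ≥0∞) * ⨅ w ∈ words Ω n, μ (wordCylinder Ω w)) atTop) :
    ∃ C : ℝ, 0 < C ∧ ∃ᶠ l in atTop, HasLargeWords μ C l := by
  obtain ⟨c, hc0, hc⟩ := ENNReal.lt_iff_exists_real_btwn.1 h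
  rw [ENNReal.ofReal_pos] at hc
  refine ⟨c, hc.1, (frequently_lt_of_lt_limsup (by isBoundedDefault) hc.2).mono fun l hl ω => ?_⟩
  have h1 : ENNReal.ofReal c ≤ l * μ (wordCylinder Ω (word l ω.1)) :=
    hl.le.trans (mul_le_mul_right (iInf₂_le _ ⟨ω.1, ω.2, rfl⟩) _)
  have h2 := ENNReal.toReal_mono
    (ENNReal.mul_ne_top (ENNReal.natCast_ne_top l) (measure_ne_top μ _)) h1
  rwa [ENNReal.toReal_ofReal hc0, ENNReal.toReal_mul, ENNReal.toReal_natCast] at h2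

section LocallyConstant

variable {𝓐 : Type*} [TopologicalSpace 𝓐] [DiscreteTopology 𝓐] {Ω : Subshift 𝓐 ℤ}
  [MeasurableSpace Ω.carrier] [BorelSpace Ω.carrier] {μ : Measure Ω.carrier}
  [IsProbabilityMeasure μ] {C : ℝ}

/-- Under the Boshernitzan condition, words of a good length `l` occur with frequency at least
`C / (2 l)` along every orbit. -/
theorem eventually_le_visits (hμ : MeasurePreserving (shiftHomeo Ω) μ μ)
    (huniq : ∀ f : C(Ω.carrier, ℝ), HasUniformAverages (shiftHomeo Ω) f) (hC : 0 < C) {l : ℕ}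
    (hl0 : 0 < l) (hlarge : HasLargeWords μ C l) (ω : Ω.carrier) :
    ∃ N : ℕ, ∀ t ≥ N, ∀ x, t * (C / (2 * l)) ≤ birkhoffSum (shiftHomeo Ω)
      ((wordCylinder Ω (word l ω.1)).indicator fun _ => (1 : ℝ)) t x := by
  set V := wordCylinder Ω (word l ω.1) with hV
  have hVm : MeasurableSet V := measurableSet_wordCylinder _
  set f : Ω.carrier → ℝ := V.indicator fun _ => (1 : ℝ) with hf
  have hfd : DependsOnWord Ω l f := by
    intro x y hxy
    have h : x ∈ V ↔ y ∈ V := by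
      change word l x.1 = _ ↔ word l y.1 = _
      rw [hxy]
    by_cases hx : x ∈ V
    · rw [hf, Set.indicator_of_mem hx, Set.indicator_of_mem (h.1 hx)]
    · rw [hf, Set.indicator_of_notMem hx, Set.indicator_of_notMem fun hy => hx (h.2 hy)]
  have hl0' : (0 : ℝ) < l := by exact_mod_cast hl0
  obtain ⟨c, hc⟩ := huniq ⟨f, hfd.continuous⟩
  obtain ⟨N, hN⟩ := tendstoUniformly_const_iff.1 hc (C / (4 * l)) (by positivity)
  have hfi : Integrable f μ := (integrable_const 1).indicator hVm
  have hN' : ∀ t ≥ N + 1, ∀ x, t * (c - C / (4 * l)) ≤ birkhoffSum (shiftHomeo Ω) f t x ∧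
      birkhoffSum (shiftHomeo Ω) f t x ≤ t * (c + C / (4 * l)) := by
    intro t ht x
    have ht0 : (0 : ℝ) < t := by exact_mod_cast (by omega : 0 < t)
    have h : |1 / (t : ℝ) * birkhoffSum (shiftHomeo Ω) f t x - c| < C / (4 * l) :=
      hN t (by omega) x
    have h1 := abs_lt.1 h
    have e : birkhoffSum (shiftHomeo Ω) f t x =
        t * (1 / (t : ℝ) * birkhoffSum (shiftHomeo Ω) f t x) := by field_simp
    rw [e]
    constructor <;> exact mul_le_mul_of_nonneg_left (by linarith) ht0.le
  -- integration shows that the limit `c` is at least the measure of the cylinder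
  have hint : C / l ≤ c + C / (4 * l) := by
    have h1 : ((N + 1 : ℕ) : ℝ) * μ.real V ≤ (N + 1 : ℕ) * (c + C / (4 * l)) := by
      have e := integral_birkhoffSum hμ hfi (N + 1)
      rw [hf, integral_indicator_const _ hVm, smul_eq_mul, mul_one, ← hf] at e
      rw [← e]
      have hS : Integrable (birkhoffSum (shiftHomeo Ω) f (N + 1)) μ :=
        integrable_finsetSum _ fun i _ => (hμ.iterate i).integrable_comp_of_integrable hfi
      have := integral_mono hS (integrable_const _) fun x => (hN' (N + 1) le_rfl x).2
      simpa using this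
    have h2 : μ.real V ≤ c + C / (4 * l) :=
      le_of_mul_le_mul_left h1 (by positivity)
    have h3 := hlarge ω
    refine le_trans ?_ h2
    rw [div_le_iff₀' hl0']
    exact h3
  refine ⟨N + 1, fun t ht x => le_trans ?_ (hN' t ht x).1⟩
  refine mul_le_mul_of_nonneg_left ?_ (Nat.cast_nonneg t)
  have e1 : C / (4 * l) = C / l / 4 := by field_simp
  have e2 : C / (2 * l) = C / l / 2 := by field_simp
  rw [e1] at hint ⊢
  rw [e2]
  linarith

/-- For a locally constant cocycle the growth over `n` steps, with `n` comparable to a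
large good length `l`, is everywhere close to maximal. A word with smaller growth would occur,
without overlaps, in a fixed proportion of every orbit, which would lower the maximal exponent. -/
theorem exists_le_logNorm [Finite 𝓐] (haper : IsAperiodic (shiftHomeo Ω))
    (hmin : IsMinimal (shiftHomeo Ω))
    (hμ : MeasurePreserving (shiftHomeo Ω) μ μ)
    (huniq : ∀ f : C(Ω.carrier, ℝ), HasUniformAverages (shiftHomeo Ω) f) (hC : 0 < C)
    {A : C(Ω.carrier, SL(2, ℝ))} {M : ℕ} (hA : DependsOnWord Ω M A) {L : ℝ}
    (hL : ∀ (n : ℕ) (B : ℝ), (∀ ω, logNorm (shiftHomeo Ω) A n ω ≤ B) → n * L ≤ B)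
    (hL' : ∀ ε > 0, ∃ K : ℝ, 0 ≤ K ∧ ∀ n ω, logNorm (shiftHomeo Ω) A n ω ≤ n * (L + ε) + K)
    {δ : ℝ} (hδ : 0 < δ) :
    ∃ l₀ : ℕ, ∀ l ≥ l₀, HasLargeWords μ C l → ∀ n, l ≤ 20 * n → 3 * (n + M) ≤ l →
      ∀ ω, n * (L - δ) ≤ logNorm (shiftHomeo Ω) A n ω := by
  set T := shiftHomeo Ω with hT
  set ε := C * δ / 160 with hε
  have hε0 : 0 < ε := by positivity
  obtain ⟨K, hK0, hK⟩ := hL' ε hε0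
  obtain ⟨l₀, hl₀⟩ := exists_nat_gt (40 * K / δ)
  refine ⟨l₀ + 1, fun l hl hlarge n hln hnl ω => ?_⟩
  by_contra! hbad
  have hl0 : 0 < l := by omega
  have hl0' : (0 : ℝ) < l := by exact_mod_cast hl0
  have hn0 : 0 < n := by omega
  have hn0' : (0 : ℝ) < n := by exact_mod_cast hn0
  have hlK : 40 * K ≤ l * δ := by
    rw [div_lt_iff₀ hδ] at hl₀
    have : (l₀ : ℝ) ≤ l := by exact_mod_cast (by omega : l₀ ≤ l)
    nlinarith
  have hln' : (l : ℝ) ≤ 20 * n := by exact_mod_cast hln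
  obtain ⟨ω₁, j, hsub, hret⟩ := exists_word_without_short_returns haper hmin ω
    (m := n + M) (l := l) (g := l / 3) (by omega)
  rw [← hT] at hsub hret
  set W := wordCylinder Ω (word l ω₁.1) with hW
  -- `V` is the set of the points where the occurrences of the bad word start
  set V : Set Ω.carrier := T^[j] '' W with hV
  have hinj : Function.Injective T^[j] := T.injective.iterate j
  have hmem : ∀ i x, T^[i] (T^[j] x) ∈ V ↔ T^[i] x ∈ W := by
    intro i x
    rw [← Function.iterate_add_apply, add_comm, Function.iterate_add_apply, hV,
      hinj.mem_set_image]
  have hVret : ∀ z ∈ V, ∀ q, 0 < q → q < n → T^[q] z ∉ V := by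
    rintro _ ⟨x, hx, rfl⟩ q hq0 hqn h
    exact hret x hx q hq0 (by omega) ((hmem q x).1 h)
  have hv : ∀ z ∈ V, logNorm T A n z ≤ logNorm T A n ω := by
    rintro _ ⟨x, hx, rfl⟩
    rw [logNorm, logNorm, hA.iter_eq (hsub x hx)]
  obtain ⟨D, hD⟩ : ∃ D, D = n * (L + ε) - logNorm T A n ω - K := ⟨_, rfl⟩
  have hDl : l * δ / 40 ≤ D := by
    have h1 : l * δ ≤ 20 * n * δ := mul_le_mul_of_nonneg_right hln' hδ.le
    have h2 : 0 < n * ε := by positivity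
    rw [hD]
    linarith
  have hD0 : 0 ≤ D := le_trans (by positivity) hDl
  obtain ⟨N, hN⟩ := eventually_le_visits hμ huniq hC hl0 hlarge ω₁
  obtain ⟨N', hN'⟩ := exists_nat_gt ((K + D) / ε)
  have hbound : ∀ x, logNorm T A (N + N') x ≤
      (N + N' : ℕ) * (L + ε) + K + D - D * ((N + N' : ℕ) * (C / (2 * l))) := by
    intro y
    obtain ⟨x, rfl⟩ := T.surjective.iterate j y
    have h1 := logNorm_le_sub_visits T A hn0 hVret hv hK hD hD0 (N + N') (T^[j] x)
    have h2 : birkhoffSum T (V.indicator fun _ => (1 : ℝ)) (N + N') (T^[j] x) =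
        birkhoffSum T (W.indicator fun _ => (1 : ℝ)) (N + N') x := by
      refine Finset.sum_congr rfl fun i _ => ?_
      by_cases h : T^[i] x ∈ W
      · rw [Set.indicator_of_mem h, Set.indicator_of_mem ((hmem i x).2 h)]
      · rw [Set.indicator_of_notMem h, Set.indicator_of_notMem fun h' => h ((hmem i x).1 h')]
    have h3 := mul_le_mul_of_nonneg_left (hN (N + N') (by omega) x) hD0
    rw [h2] at h1
    linarith
  have hfin := hL _ _ hbound
  have h1 : 2 * ε ≤ D * (C / (2 * l)) := by
    have : l * δ / 40 * (C / (2 * l)) ≤ D * (C / (2 * l)) :=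
      mul_le_mul_of_nonneg_right hDl (by positivity)
    refine le_trans (le_of_eq ?_) this
    rw [hε]
    field_simp
    norm_num
  have h2 : K + D < (N + N' : ℕ) * ε := by
    rw [div_lt_iff₀ hε0] at hN'
    push_cast
    nlinarith [(Nat.cast_nonneg N : (0 : ℝ) ≤ N)]
  have h3 := mul_le_mul_of_nonneg_left h1 (Nat.cast_nonneg (N + N') : (0 : ℝ) ≤ (N + N' : ℕ))
  nlinarith

/-- Under the Boshernitzan condition, locally constant cocycles are uniform. -/
theorem isUniform_of_dependsOnWord [Finite 𝓐] (haper : IsAperiodic (shiftHomeo Ω))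
    (hmin : IsMinimal (shiftHomeo Ω)) (hμ : MeasurePreserving (shiftHomeo Ω) μ μ)
    (huniq : ∀ f : C(Ω.carrier, ℝ), HasUniformAverages (shiftHomeo Ω) f) (hC : 0 < C)
    (hfreq : ∃ᶠ l in atTop, HasLargeWords μ C l)
    {A : C(Ω.carrier, SL(2, ℝ))} {M : ℕ} (hA : DependsOnWord Ω M A) :
    IsUniform (shiftHomeo Ω) A := by
  have : Nonempty Ω.carrier := nonempty_of_isProbabilityMeasure μ
  obtain ⟨L, hL0, hL, hL'⟩ := exists_maximal_exponent (shiftHomeo Ω) A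
  rcases hL0.eq_or_lt with h0 | hpos
  · refine isUniform_of_mem_subexponentialSet _ _ fun k => ?_
    obtain ⟨K, hK0, hK⟩ := hL' (1 / (2 * (k + 1))) (by positivity)
    obtain ⟨n, hn⟩ := exists_nat_gt (2 * (k + 1) * K)
    have hn0 : (0 : ℝ) < n := lt_of_le_of_lt (by positivity) hn
    refine ⟨n, by exact_mod_cast hn0, fun ω => (hK n ω).trans_lt ?_⟩
    rw [← h0, zero_add]
    have e : (n : ℝ) / (k + 1) = n * (1 / (2 * (k + 1))) + n / (2 * (k + 1)) := by
      field_simp; norm_num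
    rw [e]
    have : K < n / (2 * (k + 1)) := by
      rw [lt_div_iff₀ (by positivity)]; linarith
    linarith
  · refine isUniform_of_mem_hyperbolicSet _ _ huniq ?_
    set δ := L / 20 with hδ
    have hδ0 : 0 < δ := by positivity
    obtain ⟨K, hK0, hK⟩ := hL' (δ / 2) (by positivity)
    obtain ⟨l₀, hl₀⟩ := exists_le_logNorm haper hmin hμ huniq hC hA hL hL' hδ0
    obtain ⟨n₀, hn₀⟩ := exists_nat_gt (max (2 * K / δ) (4 / L))
    obtain ⟨l, hl, hlarge⟩ := frequently_atTop.1 hfreq (l₀ + 10 * (n₀ + M + 1))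
    obtain ⟨n, hn⟩ : ∃ n, n = l / 10 := ⟨_, rfl⟩
    have hn1 : n₀ + M + 1 ≤ n := by omega
    have hn' : max (2 * K / δ) (4 / L) < n :=
      hn₀.trans_le (by exact_mod_cast (by omega : n₀ ≤ n))
    have h1 : 2 * K < n * δ := by
      rw [← div_lt_iff₀ hδ0]; exact (le_max_left _ _).trans_lt hn'
    have h2 : 4 < n * L := by
      rw [← div_lt_iff₀ hpos]; exact (le_max_right _ _).trans_lt hn'
    refine mem_hyperbolicSet_of_bounds _ _ (n := n) (by omega) hδ0 (by rw [hδ]; linarith)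
      (hl₀ l (by omega) hlarge n (by omega) (by omega)) (fun ω => (hK n ω).trans (by linarith))
      fun ω => ?_
    have := hl₀ l (by omega) hlarge (2 * n) (by omega) (by omega) ω
    push_cast at this
    exact this

theorem dense_setOf_isUniform [Finite 𝓐] (haper : IsAperiodic (shiftHomeo Ω))
    (hmin : IsMinimal (shiftHomeo Ω)) (hμ : MeasurePreserving (shiftHomeo Ω) μ μ)
    (huniq : ∀ f : C(Ω.carrier, ℝ), HasUniformAverages (shiftHomeo Ω) f) (hC : 0 < C)
    (hfreq : ∃ᶠ l in atTop, HasLargeWords μ C l) :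
    Dense {A : C(Ω.carrier, SL(2, ℝ)) | IsUniform (shiftHomeo Ω) A} := by
  have : Nonempty Ω.carrier := nonempty_of_isProbabilityMeasure μ
  intro A
  refine mem_closure_of_tendsto (tendsto_comp_retractMap Ω A) (Eventually.of_forall fun N => ?_)
  set B : C(Ω.carrier, SL(2, ℝ)) := (A.comp (retractMap Ω N)).comp
    ⟨(shiftHomeo Ω)^[N + 1], continuous_iterate _ _⟩
  exact isUniform_of_comp_iterate (B := B) (k := N + 1) (fun _ => rfl)
    (isUniform_of_dependsOnWord haper hmin hμ huniq hC hfreq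
      (dependsOnWord_retract_iterate Ω A N))

end LocallyConstant

end SL2Cocycle

theorem corollary1p9 {𝓐 : Type*} [Finite 𝓐] [TopologicalSpace 𝓐] [DiscreteTopology 𝓐]
    (Ω : Subshift 𝓐 ℤ)
    (haper : SL2Cocycle.IsAperiodic (SL2Cocycle.shiftHomeo Ω))
    (hB : SL2Cocycle.Boshernitzan Ω) :
    IsGδ {A : C(Ω.carrier, SL(2, ℝ)) | SL2Cocycle.IsUniform (SL2Cocycle.shiftHomeo Ω) A} ∧
    Dense {A : C(Ω.carrier, SL(2, ℝ)) | SL2Cocycle.IsUniform (SL2Cocycle.shiftHomeo Ω) A} := by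
  obtain ⟨hmin, _, _, μ, _, hμ, hlim⟩ := hB
  obtain ⟨C, hC, hfreq⟩ := SL2Cocycle.exists_frequently_hasLargeWords hlim
  have huniq := SL2Cocycle.hasUniformAverages_of_hasLargeWords hmin hμ hC hfreq
  exact ⟨SL2Cocycle.isGδ_setOf_isUniform _ huniq,
    SL2Cocycle.dense_setOf_isUniform haper hmin hμ huniq hC hfreq⟩
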